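/- Let $0<s<1$. For measurable $u:\mathbb R^2\to\mathbb R$ put $$[u]_s^2=\iint_{\mathbb R^2\times\mathbb R^2}\frac{|u(x)-u(y)|^2}{|x-y|^{2+2s}}\,dx\,dy ,\qquad W^{s,2}(\mathbb R^2)=\{u\in L^2(\mathbb R^2): [u]_s<\infty\},\qquad \|u\|_{W^{s,2}}=\|u\|_{L^2}+[u]_s .$$ For an open set $\Omega\subset\mathbb R^2$ let $\widetilde W^{s,2}_0(\Omega)$ be the closure of $C_0^\infty(\Omega)$ in $W^{s,2}(\mathbb R^2)$, and put $$\lambda_1^s(\Omega)=\inf_{u\in\widetilde W^{s,2}_0(\Omega)\setminus\{0\}}\frac{[u]_s^2}{\|u\|_{L^2(\Omega)}^2},\qquad r_\Omega=\sup\{\rho>0:\ \exists\,x\in\Omega,\ B_\rho(x)\subset\Omega\}\in[0,\infty].$$ For $M>0$ and $1/2<s<1$ put $$\mu_s=\frac{8\pi\int_0^\pi \frac{1-\cos\tau}{\tau^{1+2s}}\,d\tau}{2\pi\left(1+2\sum_{n\ge1}n^{-2s}\right)},\qquad \mathcal T_s=\left(\frac{20(1+2s)}{3\mu_s}+\frac{8}{3\pi}M(1-s)\right)^{-1},\qquad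 \mathcal C_s=\frac{\mathcal T_s}{36\,(1+\sqrt2)^{2s}} .$$ **Theorem 1.1 (Fractional Makai–Hayman inequality).** There is a universal constant $M>0$ (independent of $s$ and $\Omega$) such that the following holds with the above $\mathcal C_s$. For every $1/2<s<1$ we have $\mathcal C_s>0$, and for every open simply connected (in particular non-empty and connected) set $\Omega\subset\mathbb R^2$ with $r_\Omega<\infty$, $$\lambda_1^s(\Omega)\ \ge\ \frac{\mathcal C_s}{r_\Omega^{2s}} .$$ Moreover, the limits $$\lim_{s\searrow1/2}\frac{\mathcal C_s}{s-\frac12}\qquad\text{and}\qquad \lim_{s\nearrow1}(1-s)\,\mathcal C_s$$ exist and are positive and finite. -/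

import Mathlib

open MeasureTheory Set Filter Topology
open scoped ENNReal NNReal ContDiff

noncomputable section

namespace FracMakaiHayman

/-- The squared Gagliardo-Slobodeckij seminorm on the whole of `ℝ^N`,
`∬ |u x - u y|² / |x - y|^(N + 2s) dx dy`, with values in `[0, ∞]`. -/
def gagliardoSq {N : ℕ} (s : ℝ) (u : EuclideanSpace ℝ (Fin N) → ℝ) : ℝ≥0∞ :=
  ∫⁻ x, ∫⁻ y, ENNReal.ofReal (|u x - u y| ^ 2 / ‖x - y‖ ^ ((N : ℝ) + 2 * s))

/-- The Gagliardo-Slobodeckij seminorm. -/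
def gagliardoSeminorm {N : ℕ} (s : ℝ) (u : EuclideanSpace ℝ (Fin N) → ℝ) : ℝ≥0∞ :=
  gagliardoSq s u ^ (1 / 2 : ℝ)

/-- The norm of `W^{s,2}(ℝ^N)`: the `L²` norm plus the Gagliardo-Slobodeckij seminorm. -/
def sobolevNorm {N : ℕ} (s : ℝ) (u : EuclideanSpace ℝ (Fin N) → ℝ) : ℝ≥0∞ :=
  eLpNorm u 2 volume + gagliardoSeminorm s u

/-- `W^{s,2}(ℝ^N)`, through representatives: square-integrable functions with finite seminorm. -/
def MemSobolev {N : ℕ} (s : ℝ) (u : EuclideanSpace ℝ (Fin N) → ℝ) : Prop :=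
  MemLp u 2 volume ∧ gagliardoSeminorm s u < ⊤

/-- `C^∞_0(Ω)`: smooth functions whose support is compact and contained in `Ω`. -/
def IsTestFunction {N : ℕ} (Ω : Set (EuclideanSpace ℝ (Fin N)))
    (φ : EuclideanSpace ℝ (Fin N) → ℝ) : Prop :=
  ContDiff ℝ ∞ φ ∧ HasCompactSupport φ ∧ tsupport φ ⊆ Ω

/-- The closure of `C^∞_0(Ω)` in `W^{s,2}(ℝ^N)` (through representatives). -/
def MemSobolevZero {N : ℕ} (s : ℝ) (Ω : Set (EuclideanSpace ℝ (Fin N)))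
    (u : EuclideanSpace ℝ (Fin N) → ℝ) : Prop :=
  MemSobolev s u ∧
    ∀ ε : ℝ≥0∞, 0 < ε → ∃ φ, IsTestFunction Ω φ ∧ sobolevNorm s (fun x => u x - φ x) < ε

/-- `λ₁^s(Ω)`: the infimum of the Rayleigh quotient `[u]² / ‖u‖²_{L²(Ω)}` over the nonzero elements
of the closure of `C^∞_0(Ω)` in `W^{s,2}(ℝ^N)`. -/
def fracEigenvalue {N : ℕ} (s : ℝ) (Ω : Set (EuclideanSpace ℝ (Fin N))) : ℝ≥0∞ :=
  ⨅ (u : EuclideanSpace ℝ (Fin N) → ℝ) (_ : MemSobolevZero s Ω u) (_ : ¬ u =ᵐ[volume] 0),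
    gagliardoSeminorm s u ^ 2 / eLpNorm u 2 (volume.restrict Ω) ^ 2

/-- The inradius of `Ω`: the supremum of the radii of the open balls that are centred at a point of
`Ω` and contained in `Ω`, as an element of `[0, ∞]`. -/
def inradius {N : ℕ} (Ω : Set (EuclideanSpace ℝ (Fin N))) : ℝ≥0∞ :=
  ⨆ (ρ : ℝ) (_ : 0 < ρ) (_ : ∃ x ∈ Ω, Metric.ball x ρ ⊆ Ω), ENNReal.ofReal ρ

/-- `8π ∫₀^π (1 - cos τ) / τ^(1 + 2s) dτ`. -/
def constC1 (s : ℝ) : ℝ :=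
  8 * Real.pi * ∫ τ in (0 : ℝ)..Real.pi, (1 - Real.cos τ) / τ ^ (1 + 2 * s)

/-- `2π (1 + 2 ∑_{n ≥ 1} n^(-2s))`. -/
def constC2 (s : ℝ) : ℝ :=
  2 * Real.pi * (1 + 2 * ∑' n : ℕ, 1 / ((n : ℝ) + 1) ^ (2 * s))

/-- `μ_s`: the quotient of the two previous constants. -/
def constMu (s : ℝ) : ℝ := constC1 s / constC2 s

/-- `T_s = (20 (1 + 2s) / (3 μ_s) + (8 / (3π)) M (1 - s))⁻¹`. -/
def constT (M s : ℝ) : ℝ :=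
  (20 * (1 + 2 * s) / (3 * constMu s) + 8 / (3 * Real.pi) * M * (1 - s))⁻¹

/-- The explicit constant `C_s = T_s / (36 (1 + √2)^(2s))`; it depends only on `s` and on a
numerical parameter `M`, which is independent of `s`. -/
def constC (M s : ℝ) : ℝ := constT M s / (36 * (1 + Real.sqrt 2) ^ (2 * s))

end FracMakaiHayman

end

noncomputable section

namespace FracMakaiHayman

/-! ### The constants -/

/-! Everything rests on a Poincaré inequality for circles. If a function on a circle vanishes at one
point, its mean is controlled by the other Fourier modes; for `2s > 1`, Cauchy-Schwarz against the
convergent series `∑ n^(-2s)` bounds the L² norm by the fractional energy, with constant `1/μ_s`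
(`circle_poincare`). The energy of a circle is in turn bounded by its interaction with the disc
inside it: the difference between two values on the circle is split at intermediate points of the
disc, over which one averages (`circle_energy_le`). Integration over radii gives a Poincaré
inequality on discs for functions with a zero on every concentric circle (`ball_poincare`).

Topology supplies the zeros. If `Ω` is simply connected and `p ∉ Ω`, then `z - p` has a logarithm on
`Ω`, so no circle about `p` lies in `Ω` (`exists_circle_point_notMem`). Every point of `Ω` has such
a `p` within distance `r_Ω`; hence each square of side `r_Ω` that meets `Ω` lies in a disc of radius
`(1 + √2) r_Ω` centred off `Ω`. At most 64 of these discs overlap at a point, so the disc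
inequalities add up to one on the plane (`plane_poincare`), which passes from test functions to
their closure.

The constant obtained is `μ_s / (480 ((1 + √2) r_Ω)^(2s))`. It dominates the required one for every
`M > 0`, because `480 = 20 · 2 · 36 / 3` and `1 + 2s ≥ 2`. The limits come from the simple pole of
`ζ(2s)` at `s = 1/2` and from the growth `1 / (4 (1 - s))` of the integral in `μ_s` as `s → 1`. -/

lemma measurable_one_sub_cos_div (s : ℝ) :
    Measurable fun τ : ℝ => (1 - Real.cos τ) / τ ^ (1 + 2 * s) :=
  (measurable_const.sub Real.measurable_cos).div (measurable_id.pow_const _)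

lemma intervalIntegrable_one_sub_cos_div {s b : ℝ} (hs : s < 1) (hb : 0 ≤ b) :
    IntervalIntegrable (fun τ : ℝ => (1 - Real.cos τ) / τ ^ (1 + 2 * s)) volume 0 b := by
  have hi : IntervalIntegrable (fun τ : ℝ => τ ^ (1 - 2 * s)) volume 0 b :=
    intervalIntegral.intervalIntegrable_rpow' (by linarith)
  refine hi.mono_fun' (measurable_one_sub_cos_div s).aestronglyMeasurable ?_
  filter_upwards [ae_restrict_mem measurableSet_uIoc] with τ hτ
  rw [uIoc_of_le hb] at hτ
  have h1 := Real.one_sub_sq_div_two_le_cos (x := τ)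
  have h2 := Real.cos_le_one τ
  have hp : 0 < τ ^ (1 + 2 * s) := Real.rpow_pos_of_pos hτ.1 _
  rw [Real.norm_of_nonneg (by apply div_nonneg <;> linarith), div_le_iff₀ hp,
    ← Real.rpow_add hτ.1, show 1 - 2 * s + (1 + 2 * s) = 2 by ring, Real.rpow_two]
  nlinarith [sq_nonneg τ]

lemma integral_one_sub_cos_div_pos {s : ℝ} (hs : s < 1) :
    0 < ∫ τ in (0 : ℝ)..Real.pi, (1 - Real.cos τ) / τ ^ (1 + 2 * s) := by
  refine intervalIntegral.intervalIntegral_pos_of_pos_on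
    (intervalIntegrable_one_sub_cos_div hs Real.pi_pos.le) (fun τ hτ => ?_) Real.pi_pos
  refine div_pos ?_ (Real.rpow_pos_of_pos hτ.1 _)
  have := Real.cos_lt_cos_of_nonneg_of_le_pi le_rfl hτ.2.le hτ.1
  rw [Real.cos_zero] at this
  linarith

lemma constC1_pos {s : ℝ} (hs : s < 1) : 0 < constC1 s :=
  mul_pos (mul_pos (by norm_num) Real.pi_pos) (integral_one_sub_cos_div_pos hs)

lemma constC2_pos (s : ℝ) : 0 < constC2 s := by
  have : 0 ≤ ∑' n : ℕ, 1 / ((n : ℝ) + 1) ^ (2 * s) := tsum_nonneg fun n => by positivity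
  have := Real.pi_pos
  unfold constC2
  positivity

lemma constMu_pos {s : ℝ} (hs : s < 1) : 0 < constMu s := div_pos (constC1_pos hs) (constC2_pos s)

lemma constT_pos {M s : ℝ} (hM : 0 < M) (h0 : 0 < s) (hs : s < 1) : 0 < constT M s := by
  have := constMu_pos hs
  have := Real.pi_pos
  have : 0 < 1 - s := by linarith
  unfold constT
  positivity

lemma constC_pos {M s : ℝ} (hM : 0 < M) (h0 : 0 < s) (hs : s < 1) : 0 < constC M s := by
  have := constT_pos hM h0 hs
  unfold constC
  positivity

/-- The term containing `M` is positive and only lowers the constant. This is why the geometric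
argument never needs a particular `M`. -/
lemma constT_le {M s : ℝ} (hM : 0 < M) (h0 : 0 < s) (hs : s < 1) :
    constT M s ≤ 3 * constMu s / (20 * (1 + 2 * s)) := by
  have hμ := constMu_pos hs
  have := Real.pi_pos
  have : 0 < 1 - s := by linarith
  rw [constT, ← inv_div (20 * (1 + 2 * s)) (3 * constMu s)]
  refine inv_anti₀ (by positivity) (le_add_of_nonneg_right (by positivity))

/-! ### Behaviour of the constants as `s` tends to `1/2` and to `1` -/

lemma summable_one_div_nat_add_one_rpow {t : ℝ} (ht : 1 < t) :
    Summable fun n : ℕ => 1 / ((n : ℝ) + 1) ^ t := by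
  have := (summable_nat_add_iff 1).2 (Real.summable_one_div_nat_rpow.2 ht)
  simpa using this

lemma tendsto_sub_mul_tsum_nat_add_one_rpow :
    Tendsto (fun t : ℝ => (t - 1) * ∑' n : ℕ, 1 / ((n : ℝ) + 1) ^ t) (𝓝[>] 1) (𝓝 1) := by
  refine tendsto_sub_mul_tsum_nat_rpow.congr' ?_
  filter_upwards [self_mem_nhdsWithin] with t ht
  have ht : 1 < t := ht
  -- The term `n = 0` is `1 / 0 ^ t = 0`, so the two indexings have the same sum.
  rw [(Real.summable_one_div_nat_rpow.2 ht).tsum_eq_zero_add]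
  simp [Real.zero_rpow (by linarith : t ≠ 0)]

lemma tendsto_sub_half_mul_constC2 :
    Tendsto (fun s : ℝ => (s - 1 / 2) * constC2 s) (𝓝[>] (1 / 2)) (𝓝 (2 * Real.pi)) := by
  have h2 : Tendsto (fun s : ℝ => 2 * s) (𝓝[>] (1 / 2)) (𝓝[>] 1) := by
    refine tendsto_nhdsWithin_iff.2 ⟨?_, ?_⟩
    · have : Tendsto (fun s : ℝ => 2 * s) (𝓝 (1 / 2)) (𝓝 (2 * (1 / 2))) :=
        (continuous_const.mul continuous_id).tendsto _
      rw [show (2 : ℝ) * (1 / 2) = 1 by norm_num] at this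
      exact this.mono_left nhdsWithin_le_nhds
    · filter_upwards [self_mem_nhdsWithin] with s hs
      have hs : 1 / 2 < s := hs
      show 1 < 2 * s
      linarith
  have h := tendsto_sub_mul_tsum_nat_add_one_rpow.comp h2
  have h1 : Tendsto (fun s : ℝ => 2 * Real.pi * (s - 1 / 2)) (𝓝[>] (1 / 2)) (𝓝 0) := by
    have : Tendsto (fun s : ℝ => 2 * Real.pi * (s - 1 / 2)) (𝓝 (1 / 2))
        (𝓝 (2 * Real.pi * (1 / 2 - 1 / 2))) := Continuous.tendsto (by fun_prop) _
    rw [sub_self, mul_zero] at this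
    exact this.mono_left nhdsWithin_le_nhds
  have := h1.add (h.const_mul (2 * Real.pi))
  rw [zero_add, mul_one] at this
  refine this.congr fun s => ?_
  simp only [Function.comp_apply, constC2]
  ring

lemma tendsto_constC2_one : Tendsto constC2 (𝓝[<] 1) (𝓝 (constC2 1)) := by
  have h : Tendsto (fun s : ℝ => ∑' n : ℕ, 1 / ((n : ℝ) + 1) ^ (2 * s)) (𝓝[<] 1)
      (𝓝 (∑' n : ℕ, 1 / ((n : ℝ) + 1) ^ (2 * (1 : ℝ)))) := by
    refine tendsto_tsum_of_dominated_convergence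
      (bound := fun n : ℕ => 1 / ((n : ℝ) + 1) ^ (3 / 2 : ℝ))
      (summable_one_div_nat_add_one_rpow (by norm_num)) (fun n => ?_) ?_
    · have hn : (0 : ℝ) < (n : ℝ) + 1 := by positivity
      have hc : Continuous fun s : ℝ => 1 / ((n : ℝ) + 1) ^ (2 * s) :=
        continuous_const.div
          (Continuous.rpow continuous_const (by fun_prop) fun _ => Or.inl hn.ne')
          fun s => (Real.rpow_pos_of_pos hn _).ne'
      exact (hc.tendsto 1).mono_left nhdsWithin_le_nhds
    · have : ∀ᶠ s : ℝ in 𝓝[<] 1, 3 / 4 < s :=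
        nhdsWithin_le_nhds (lt_mem_nhds (by norm_num))
      filter_upwards [this] with s hs n
      have hn : (1 : ℝ) ≤ (n : ℝ) + 1 := by simp
      rw [Real.norm_of_nonneg (by positivity)]
      exact one_div_le_one_div_of_le (by positivity)
        (Real.rpow_le_rpow_of_exponent_le hn (by linarith))
  exact ((h.const_mul 2).const_add 1).const_mul (2 * Real.pi)

lemma tendsto_constC1_half : Tendsto constC1 (𝓝[>] (1 / 2)) (𝓝 (constC1 (1 / 2))) := by
  refine Tendsto.const_mul _ ?_
  have hev : ∀ᶠ s : ℝ in 𝓝[>] (1 / 2), 1 / 2 < s ∧ s < 3 / 4 :=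
    Ioo_mem_nhdsGT (by norm_num)
  refine intervalIntegral.tendsto_integral_filter_of_dominated_convergence
    (fun τ : ℝ => τ ^ (-(1 / 2) : ℝ) + 1) ?_ ?_ ?_ ?_
  · exact Eventually.of_forall fun s => (measurable_one_sub_cos_div s).aestronglyMeasurable
  · filter_upwards [hev] with s hs
    refine ae_of_all _ fun τ hτ => ?_
    rw [uIoc_of_le Real.pi_pos.le] at hτ
    have h1 := Real.one_sub_sq_div_two_le_cos (x := τ)
    have h2 := Real.cos_le_one τ
    have hp : 0 < τ ^ (1 + 2 * s) := Real.rpow_pos_of_pos hτ.1 _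
    -- Since `1 - cos τ ≤ τ² / 2`, the integrand is below `τ^(1 - 2s)`, whose exponent lies in
    -- `(-1/2, 0)`: the first summand dominates for `τ ≤ 1`, the second for `τ ≥ 1`.
    have h3 : τ ^ (1 - 2 * s) ≤ τ ^ (-(1 / 2) : ℝ) + 1 := by
      rcases le_total τ 1 with h | h
      · have := Real.rpow_le_rpow_of_exponent_ge hτ.1 h
          (show (-(1 / 2) : ℝ) ≤ 1 - 2 * s by linarith [hs.2])
        linarith
      · have := Real.rpow_le_one_of_one_le_of_nonpos h (show 1 - 2 * s ≤ 0 by linarith [hs.1])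
        have := Real.rpow_nonneg hτ.1.le (-(1 / 2) : ℝ)
        linarith
    rw [Real.norm_of_nonneg (by apply div_nonneg <;> linarith), div_le_iff₀ hp]
    have h4 : τ ^ (1 - 2 * s) * τ ^ (1 + 2 * s) = τ ^ 2 := by
      rw [← Real.rpow_add hτ.1, show 1 - 2 * s + (1 + 2 * s) = 2 by ring, Real.rpow_two]
    nlinarith [sq_nonneg τ]
  · exact (intervalIntegral.intervalIntegrable_rpow' (by norm_num)).add
      intervalIntegrable_const
  · refine ae_of_all _ fun τ hτ => ?_
    rw [uIoc_of_le Real.pi_pos.le] at hτ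
    have hc : Continuous fun s : ℝ => (1 - Real.cos τ) / τ ^ (1 + 2 * s) :=
      continuous_const.div
        (Continuous.rpow continuous_const (by fun_prop) fun _ => Or.inl hτ.1.ne')
        fun s => (Real.rpow_pos_of_pos hτ.1 _).ne'
    exact (hc.tendsto _).mono_left nhdsWithin_le_nhds

/-- The remainder must be of fourth order: divided by `τ^(1 + 2s)` it becomes `τ^(3 - 2s)`, whose
integral stays bounded as `s → 1`. The value 3 is a crude choice that also covers `|x| ≥ 1`. -/
lemma abs_one_sub_cos_sub_le (x : ℝ) : |1 - Real.cos x - x ^ 2 / 2| ≤ 3 * x ^ 4 := by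
  rcases le_total |x| 1 with h | h
  · have h1 := Real.cos_bound h
    rw [abs_sub_comm, show 1 - x ^ 2 / 2 - Real.cos x = 1 - Real.cos x - x ^ 2 / 2 by ring] at h1
    have : |x| ^ 4 = x ^ 4 := by rw [← abs_pow, abs_of_nonneg (by positivity)]
    rw [this] at h1
    nlinarith [show 0 ≤ x ^ 4 by positivity]
  · have h1 : 1 ≤ x ^ 2 := by rw [← sq_abs]; nlinarith
    rw [abs_le]
    have := Real.cos_le_one x
    have := Real.neg_one_le_cos x
    constructor <;> nlinarith

/-- Only the leading term `τ² / 2` of `1 - cos τ` is singular in the limit; it integrates to `π^(2 -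
2s) / (4 (1 - s))`. The factor `8π` turns `1/4` into `2π`. -/
lemma tendsto_one_sub_mul_constC1 :
    Tendsto (fun s : ℝ => (1 - s) * constC1 s) (𝓝[<] 1) (𝓝 (2 * Real.pi)) := by
  have hev : ∀ᶠ s : ℝ in 𝓝[<] 1, 1 / 2 < s ∧ s < 1 :=
    Ioo_mem_nhdsLT (by norm_num)
  have hπ := Real.pi_pos
  have hcont : ∀ c : ℝ, Continuous fun s : ℝ => Real.pi ^ (c - 2 * s) := fun c =>
    Continuous.rpow continuous_const (by fun_prop) fun _ => Or.inl hπ.ne'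
  have hmain : Tendsto (fun s : ℝ => (1 - s) * ∫ τ in (0 : ℝ)..Real.pi,
      (1 - Real.cos τ) / τ ^ (1 + 2 * s)) (𝓝[<] 1) (𝓝 (1 / 4)) := by
    have h1 : Tendsto (fun s : ℝ => Real.pi ^ (2 - 2 * s) / 4) (𝓝[<] 1) (𝓝 (1 / 4)) := by
      have := ((hcont 2).tendsto 1).mono_left (nhdsWithin_le_nhds (s := Iio 1))
      simpa using this.div_const 4
    have h2 : Tendsto (fun s : ℝ => (1 - s) * (3 * (Real.pi ^ (4 - 2 * s) / (4 - 2 * s))))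
        (𝓝[<] 1) (𝓝 0) := by
      have ha : Tendsto (fun s : ℝ => Real.pi ^ (4 - 2 * s) / (4 - 2 * s)) (𝓝 1)
          (𝓝 (Real.pi ^ (4 - 2 * (1 : ℝ)) / (4 - 2 * 1))) :=
        ((hcont 4).tendsto 1).div (Continuous.tendsto (by fun_prop) _) (by norm_num)
      have hb : Tendsto (fun s : ℝ => 1 - s) (𝓝 1) (𝓝 (1 - 1)) :=
        Continuous.tendsto (by fun_prop) _
      have := hb.mul (ha.const_mul 3)
      rw [sub_self, zero_mul] at this
      exact this.mono_left nhdsWithin_le_nhds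
    have h3 : Tendsto (fun s : ℝ => (1 - s) * (∫ τ in (0 : ℝ)..Real.pi,
        (1 - Real.cos τ) / τ ^ (1 + 2 * s)) - Real.pi ^ (2 - 2 * s) / 4) (𝓝[<] 1) (𝓝 0) := by
      refine squeeze_zero_norm' ?_ h2
      filter_upwards [hev] with s hs
      have e1 : ∫ τ in (0 : ℝ)..Real.pi, τ ^ (1 - 2 * s) / 2 =
          Real.pi ^ (2 - 2 * s) / (2 - 2 * s) / 2 := by
        rw [intervalIntegral.integral_div, integral_rpow (Or.inl (by linarith)),
          show 1 - 2 * s + 1 = 2 - 2 * s by ring, Real.zero_rpow (by linarith), sub_zero]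
      have e2 : ∫ τ in (0 : ℝ)..Real.pi, 3 * τ ^ (3 - 2 * s) =
          3 * (Real.pi ^ (4 - 2 * s) / (4 - 2 * s)) := by
        rw [intervalIntegral.integral_const_mul, integral_rpow (Or.inl (by linarith)),
          show 3 - 2 * s + 1 = 4 - 2 * s by ring, Real.zero_rpow (by linarith), sub_zero]
      have e3 : Real.pi ^ (2 - 2 * s) / 4 =
          (1 - s) * ∫ τ in (0 : ℝ)..Real.pi, τ ^ (1 - 2 * s) / 2 := by
        rw [e1]
        have : 1 - s ≠ 0 := by linarith [hs.2]
        rw [show 2 - 2 * s = 2 * (1 - s) by ring]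
        field_simp
        norm_num
      rw [e3, ← mul_sub, norm_mul, Real.norm_of_nonneg (by linarith), ← e2,
        ← intervalIntegral.integral_sub (intervalIntegrable_one_sub_cos_div hs.2 hπ.le)
          ((intervalIntegral.intervalIntegrable_rpow' (by linarith)).div_const _)]
      refine mul_le_mul_of_nonneg_left ?_ (by linarith)
      refine intervalIntegral.norm_integral_le_of_norm_le hπ.le (ae_of_all _ fun τ hτ => ?_)
        ((intervalIntegral.intervalIntegrable_rpow' (by linarith)).const_mul _)
      have hp : 0 < τ ^ (1 + 2 * s) := Real.rpow_pos_of_pos hτ.1 _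
      have e4 : τ ^ (1 - 2 * s) = τ ^ 2 / τ ^ (1 + 2 * s) := by
        rw [eq_div_iff hp.ne', ← Real.rpow_add hτ.1, show 1 - 2 * s + (1 + 2 * s) = 2 by ring,
          Real.rpow_two]
      have e5 : τ ^ (3 - 2 * s) = τ ^ 4 / τ ^ (1 + 2 * s) := by
        rw [eq_div_iff hp.ne', ← Real.rpow_add hτ.1,
          show 3 - 2 * s + (1 + 2 * s) = (4 : ℕ) by push_cast; ring, Real.rpow_natCast]
      rw [e4, e5, div_right_comm, ← sub_div, norm_div, Real.norm_of_nonneg hp.le,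
        ← mul_div_assoc, Real.norm_eq_abs]
      exact div_le_div_of_nonneg_right (abs_one_sub_cos_sub_le τ) hp.le
    have := h3.add h1
    rw [zero_add] at this
    exact this.congr fun s => by ring
  have := hmain.const_mul (8 * Real.pi)
  rw [show 8 * Real.pi * (1 / 4) = 2 * Real.pi by ring] at this
  exact this.congr fun s => by rw [constC1]; ring

/-- The pole of `constC2` makes `1 / μ_s` grow like `1 / (s - 1/2)`, while the term with `M` stays
bounded and drops out. The number `L` below is the limit of `(s - 1/2) / C_s`. -/
lemma exists_tendsto_constC_half (M : ℝ) :
    ∃ a : ℝ, 0 < a ∧ Tendsto (fun s : ℝ => constC M s / (s - 1 / 2)) (𝓝[>] (1 / 2)) (𝓝 a) := by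
  have hπ := Real.pi_pos
  have hC1 : 0 < constC1 (1 / 2) := constC1_pos (by norm_num)
  have hid : ∀ f : ℝ → ℝ, Continuous f → Tendsto f (𝓝[>] (1 / 2)) (𝓝 (f (1 / 2))) :=
    fun f hf => (hf.tendsto _).mono_left nhdsWithin_le_nhds
  have h1 := (tendsto_sub_half_mul_constC2.div tendsto_constC1_half hC1.ne').mul
    (hid (fun s => 20 * (1 + 2 * s) / 3) (by fun_prop))
  have h2 := h1.add (hid (fun s => 8 / (3 * Real.pi) * M * (1 - s) * (s - 1 / 2)) (by fun_prop))
  have hr : Continuous fun s : ℝ => 36 * (1 + Real.sqrt 2) ^ (2 * s) :=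
    continuous_const.mul (Continuous.rpow continuous_const (by fun_prop)
      fun _ => Or.inl (by positivity))
  have h3 := h2.mul (hid _ hr)
  set L : ℝ := (2 * Real.pi / constC1 (1 / 2) * (20 * (1 + 2 * (1 / 2)) / 3) +
    8 / (3 * Real.pi) * M * (1 - 1 / 2) * (1 / 2 - 1 / 2)) *
    (36 * (1 + Real.sqrt 2) ^ (2 * (1 / 2 : ℝ))) with hL
  have hLpos : 0 < L := by
    rw [hL, sub_self, mul_zero, add_zero]
    positivity
  refine ⟨L⁻¹, inv_pos.2 hLpos, (h3.inv₀ hLpos.ne').congr' ?_⟩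
  have hev : ∀ᶠ s : ℝ in 𝓝[>] (1 / 2), 1 / 2 < s ∧ s < 1 :=
    Ioo_mem_nhdsGT (by norm_num)
  filter_upwards [hev] with s hs
  have hs1 : 0 < s - 1 / 2 := by linarith [hs.1]
  have := constC1_pos hs.2
  have := constC2_pos s
  have hr0 : 0 < (1 + Real.sqrt 2) ^ (2 * s) := by positivity
  have key : (s - 1 / 2) * (20 * (1 + 2 * s) / (3 * constMu s) +
        8 / (3 * Real.pi) * M * (1 - s)) =
      (s - 1 / 2) * constC2 s / constC1 s * (20 * (1 + 2 * s) / 3) +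
        8 / (3 * Real.pi) * M * (1 - s) * (s - 1 / 2) := by
    rw [constMu]
    field_simp
  rw [constC, constT, div_div, mul_comm (36 * _) (s - 1 / 2), Pi.div_apply, ← key]
  simp only [mul_inv, div_eq_mul_inv]
  ring

/-- Here `constC1` grows like `2π / (1 - s)`, so both terms of `1 / T_s` are of order `1 - s`, and
`M` survives in the limit. -/
lemma exists_tendsto_constC_one {M : ℝ} (hM : 0 < M) :
    ∃ b : ℝ, 0 < b ∧ Tendsto (fun s : ℝ => constC M s / (1 / (1 - s))) (𝓝[<] 1) (𝓝 b) := by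
  have hπ := Real.pi_pos
  have hC2 := constC2_pos 1
  have hid : ∀ f : ℝ → ℝ, Continuous f → Tendsto f (𝓝[<] 1) (𝓝 (f 1)) :=
    fun f hf => (hf.tendsto _).mono_left nhdsWithin_le_nhds
  have h1 := (tendsto_constC2_one.div tendsto_one_sub_mul_constC1 (by positivity)).mul
    (hid (fun s => 20 * (1 + 2 * s) / 3) (by fun_prop))
  have h2 := h1.add_const (8 / (3 * Real.pi) * M)
  have hr : Continuous fun s : ℝ => 36 * (1 + Real.sqrt 2) ^ (2 * s) :=
    continuous_const.mul (Continuous.rpow continuous_const (by fun_prop)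
      fun _ => Or.inl (by positivity))
  have h3 := h2.mul (hid _ hr)
  set L : ℝ := (constC2 1 / (2 * Real.pi) * (20 * (1 + 2 * 1) / 3) +
    8 / (3 * Real.pi) * M) * (36 * (1 + Real.sqrt 2) ^ (2 * (1 : ℝ))) with hL
  have hLpos : 0 < L := by positivity
  refine ⟨L⁻¹, inv_pos.2 hLpos, (h3.inv₀ hLpos.ne').congr' ?_⟩
  have hev : ∀ᶠ s : ℝ in 𝓝[<] 1, 1 / 2 < s ∧ s < 1 :=
    Ioo_mem_nhdsLT (by norm_num)
  filter_upwards [hev] with s hs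
  have hs1 : 0 < 1 - s := by linarith [hs.2]
  have := constC1_pos hs.2
  have := constC2_pos s
  have hr0 : 0 < (1 + Real.sqrt 2) ^ (2 * s) := by positivity
  have key : 20 * (1 + 2 * s) / (3 * constMu s) + 8 / (3 * Real.pi) * M * (1 - s) =
      (1 - s) * (constC2 s / ((1 - s) * constC1 s) * (20 * (1 + 2 * s) / 3) +
        8 / (3 * Real.pi) * M) := by
    rw [constMu]
    field_simp
  rw [constC, constT, key, Pi.div_apply]
  set A := constC2 s / ((1 - s) * constC1 s) * (20 * (1 + 2 * s) / 3) + 8 / (3 * Real.pi) * M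
  have hA : 0 < A := by
    have := hs.1
    positivity
  field_simp

/-! ### A Poincaré inequality on the circle -/

/-- An absolutely convergent Fourier series that vanishes at a point has its `ℓ²` norm controlled by
the homogeneous `H^s` norm. -/
lemma tsum_sq_le_of_tsum_mul_eq_zero {s : ℝ} (hs : 1 / 2 < s) {c w : ℤ → ℂ}
    (hw : ∀ n, ‖w n‖ = 1) (h0 : Summable c → ∑' n, c n * w n = 0) :
    ∑' n, ENNReal.ofReal (‖c n‖ ^ 2) ≤
      ENNReal.ofReal (1 + 2 * ∑' n : ℕ, 1 / ((n : ℝ) + 1) ^ (2 * s)) *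
        ∑' n : ℤ, ENNReal.ofReal (|(n : ℝ)| ^ (2 * s) * ‖c n‖ ^ 2) := by
  set Z : ℝ := ∑' n : ℕ, 1 / ((n : ℝ) + 1) ^ (2 * s) with hZ
  have hZ0 : 0 ≤ Z := tsum_nonneg fun n => by positivity
  by_cases hS : ∑' n : ℤ, ENNReal.ofReal (|(n : ℝ)| ^ (2 * s) * ‖c n‖ ^ 2) = ⊤
  · rw [hS, ENNReal.mul_top (by simpa using by positivity)]
    exact le_top
  have hb0 : ∀ n : ℤ, 0 ≤ |(n : ℝ)| ^ (2 * s) * ‖c n‖ ^ 2 := fun n => by positivity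
  have hb : Summable fun n : ℤ => |(n : ℝ)| ^ (2 * s) * ‖c n‖ ^ 2 := by
    have := ENNReal.summable_toReal hS
    simpa only [ENNReal.toReal_ofReal (hb0 _)] using this
  have hZs : HasSum (fun n : ℕ => 1 / ((n : ℝ) + 1) ^ (2 * s)) Z :=
    (summable_one_div_nat_add_one_rpow (by linarith)).hasSum
  -- As `0 ^ (-(2 * s)) = 0`, the sum over all integers is exactly twice the sum over the positive
  -- ones.
  have ha : HasSum (fun n : ℤ => |(n : ℝ)| ^ (-(2 * s))) (2 * Z) := by
    rw [two_mul Z]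
    refine HasSum.of_nat_of_neg_add_one (f := fun n : ℤ => |(n : ℝ)| ^ (-(2 * s))) ?_ ?_
    · refine (hasSum_nat_add_iff' 1).1 ?_
      simp only [Finset.range_one, Finset.sum_singleton, Nat.cast_zero, Int.cast_zero, abs_zero,
        Real.zero_rpow (show -(2 * s) ≠ 0 by linarith), sub_zero]
      refine (congrArg (fun g : ℕ → ℝ => HasSum g Z) (funext fun n => ?_)).mpr hZs
      push_cast
      rw [abs_of_pos (by positivity), Real.rpow_neg (by positivity), one_div]
    · refine (congrArg (fun g : ℕ → ℝ => HasSum g Z) (funext fun n => ?_)).mpr hZs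
      push_cast
      rw [abs_neg, abs_of_pos (by positivity), Real.rpow_neg (by positivity), one_div]
  have hd : ∀ n : ℤ, |(n : ℝ)| ^ (-s) * (|(n : ℝ)| ^ s * ‖c n‖) = if n = 0 then 0 else ‖c n‖ := by
    intro n
    split_ifs with h
    · simp [h, Real.zero_rpow (show s ≠ 0 by linarith)]
    · have : 0 < |(n : ℝ)| := abs_pos.2 (by exact_mod_cast h)
      rw [← mul_assoc, ← Real.rpow_add this]
      simp
  have hsqa : ∀ n : ℤ, (|(n : ℝ)| ^ (-s)) ^ (2 : ℝ) = |(n : ℝ)| ^ (-(2 * s)) := fun n => by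
    rw [← Real.rpow_mul (abs_nonneg _)]; ring_nf
  have hsqb : ∀ n : ℤ, (|(n : ℝ)| ^ s * ‖c n‖) ^ (2 : ℝ) = |(n : ℝ)| ^ (2 * s) * ‖c n‖ ^ 2 :=
    fun n => by
      rw [Real.mul_rpow (by positivity) (by positivity), ← Real.rpow_mul (abs_nonneg _),
        Real.rpow_two, mul_comm s]
  set B : ℝ := ∑' n : ℤ, |(n : ℝ)| ^ (2 * s) * ‖c n‖ ^ 2 with hB
  have hB0 : 0 ≤ B := tsum_nonneg hb0
  -- Cauchy-Schwarz: `C` is the sum of `‖c n‖` over `n ≠ 0`. Its finiteness also gives the absolute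
  -- convergence that `h0` requires.
  obtain ⟨C, hC0, hCle, hCs⟩ := Real.inner_le_Lp_mul_Lq_hasSum_of_nonneg
    (f := fun n : ℤ => |(n : ℝ)| ^ (-s)) (g := fun n : ℤ => |(n : ℝ)| ^ s * ‖c n‖)
    (p := 2) (q := 2) (by norm_num [Real.holderConjugate_iff]) (A := Real.sqrt (2 * Z))
    (B := Real.sqrt B) (by positivity) (by positivity) (fun n => by positivity)
    (fun n => by positivity)
    (by
      simp only [hsqa]
      rwa [Real.rpow_two, Real.sq_sqrt (by positivity)])
    (by
      simp only [hsqb]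
      rw [Real.rpow_two, Real.sq_sqrt hB0]
      exact hb.hasSum)
  simp only [hd] at hCs
  have hcn : Summable fun n => ‖c n‖ := by
    have := hCs.summable.add (summable_of_ne_finset_zero (s := {0})
      (f := fun n : ℤ => if n = 0 then ‖c 0‖ else 0) (by simp +contextual))
    refine this.congr fun n => ?_
    split_ifs with h <;> simp [h]
  have hcw : Summable fun n => c n * w n := by
    refine Summable.of_norm (hcn.congr fun n => ?_)
    rw [norm_mul, hw, mul_one]
  have hc0 : ‖c 0‖ ≤ C := by
    have h1 := hcw.tsum_eq_add_tsum_ite 0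
    rw [h0 hcn.of_norm] at h1
    have h2 : c 0 * w 0 = -∑' n, if n = 0 then 0 else c n * w n :=
      eq_neg_of_add_eq_zero_left h1.symm
    have h3 : ∀ n, ‖(if n = 0 then 0 else c n * w n : ℂ)‖ = if n = 0 then 0 else ‖c n‖ := by
      intro n; split_ifs <;> simp [hw]
    calc ‖c 0‖ = ‖c 0 * w 0‖ := by rw [norm_mul, hw, mul_one]
      _ ≤ ∑' n, ‖(if n = 0 then 0 else c n * w n : ℂ)‖ := by
        rw [h2, norm_neg]
        exact norm_tsum_le_tsum_norm (by simpa only [h3] using hCs.summable)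
      _ = C := by simp only [h3]; exact hCs.tsum_eq
  have hc0sq : ‖c 0‖ ^ 2 ≤ 2 * Z * B := by
    calc ‖c 0‖ ^ 2 ≤ (Real.sqrt (2 * Z) * Real.sqrt B) ^ 2 := by gcongr; exact hc0.trans hCle
      _ = 2 * Z * B := by rw [mul_pow, Real.sq_sqrt (by positivity), Real.sq_sqrt hB0]
  -- Since `|n| ≥ 1` for `n ≠ 0`, the nonzero modes contribute at most `B`, and the zero mode at
  -- most `2 Z B`; hence the factor `1 + 2 Z`.
  have hle : ∀ n : ℤ, ‖c n‖ ^ 2 ≤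
      (if n = 0 then ‖c 0‖ ^ 2 else 0) + |(n : ℝ)| ^ (2 * s) * ‖c n‖ ^ 2 := by
    intro n
    split_ifs with h
    · subst h; simpa using hb0 0
    · have : (1 : ℝ) ≤ |(n : ℝ)| := by exact_mod_cast Int.one_le_abs h
      have := Real.one_le_rpow this (show 0 ≤ 2 * s by linarith)
      nlinarith [sq_nonneg ‖c n‖]
  calc ∑' n, ENNReal.ofReal (‖c n‖ ^ 2)
      ≤ ∑' n : ℤ, ((if n = 0 then ENNReal.ofReal (‖c 0‖ ^ 2) else 0) +
          ENNReal.ofReal (|(n : ℝ)| ^ (2 * s) * ‖c n‖ ^ 2)) := by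
        refine ENNReal.tsum_le_tsum fun n => (ENNReal.ofReal_le_ofReal (hle n)).trans ?_
        rw [ENNReal.ofReal_add (by split_ifs <;> positivity) (hb0 n)]
        split_ifs <;> simp
    _ = ENNReal.ofReal (‖c 0‖ ^ 2) + ENNReal.ofReal B := by
        rw [ENNReal.tsum_add, tsum_ite_eq, ENNReal.ofReal_tsum_of_nonneg hb0 hb]
    _ ≤ ENNReal.ofReal (1 + 2 * Z) * ENNReal.ofReal B := by
        rw [← ENNReal.ofReal_add (by positivity) hB0, ← ENNReal.ofReal_mul (by positivity)]
        exact ENNReal.ofReal_le_ofReal (by linarith)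
    _ = _ := by rw [ENNReal.ofReal_tsum_of_nonneg hb0 hb]

section Circle

instance fact_two_pi_pos : Fact (0 < 2 * Real.pi) := ⟨Real.two_pi_pos⟩

/-- Parseval holds for normalised Haar measure; the factor `T` converts it to Lebesgue measure on
the circle. -/
lemma lintegral_norm_sq_eq_tsum_fourierCoeff {T : ℝ} [hT : Fact (0 < T)] (F : C(AddCircle T, ℂ)) :
    ∫⁻ x, ENNReal.ofReal (‖F x‖ ^ 2) =
      ENNReal.ofReal T * ∑' n, ENNReal.ofReal (‖fourierCoeff F n‖ ^ 2) := by
  have h := hasSum_sq_fourierCoeff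
    (ContinuousMap.toLp (E := ℂ) 2 (AddCircle.haarAddCircle (T := T)) ℂ F)
  simp_rw [fourierCoeff_toLp] at h
  have hcongr : ∫ t : AddCircle T, ‖(ContinuousMap.toLp (E := ℂ) 2
      (AddCircle.haarAddCircle (T := T)) ℂ F) t‖ ^ 2 ∂AddCircle.haarAddCircle =
      ∫ t : AddCircle T, ‖F t‖ ^ 2 ∂AddCircle.haarAddCircle := by
    refine integral_congr_ae ?_
    filter_upwards [ContinuousMap.coeFn_toLp (p := 2) (𝕜 := ℂ)
      (AddCircle.haarAddCircle (T := T)) F] with x hx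
    rw [hx]
  rw [hcongr] at h
  rw [AddCircle.volume_eq_smul_haarAddCircle, lintegral_smul_measure, smul_eq_mul,
    ← ENNReal.ofReal_tsum_of_nonneg (fun n => by positivity) h.summable, h.tsum_eq,
    ofReal_integral_eq_lintegral_ofReal _ (ae_of_all _ fun x => by positivity)]
  have hc : Continuous fun x => ‖F x‖ ^ 2 := by fun_prop
  exact hc.integrable_of_hasCompactSupport (HasCompactSupport.of_compactSpace _)

/-- Translation differences are diagonal in the Fourier basis, so the energy of a circle can be
computed mode by mode. -/
lemma fourierCoeff_translate_sub {T : ℝ} [hT : Fact (0 < T)] (F : C(AddCircle T, ℂ))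
    (τ : AddCircle T) (n : ℤ) :
    fourierCoeff (fun x => F (x + τ) - F x) n = (fourier n τ - 1) * fourierCoeff F n := by
  have hint : ∀ G : AddCircle T → ℂ, Continuous G →
      Integrable G AddCircle.haarAddCircle := fun G hG =>
    hG.integrable_of_hasCompactSupport (HasCompactSupport.of_compactSpace _)
  have h1 : ∫ x : AddCircle T, fourier (-n) x • F (x + τ) ∂AddCircle.haarAddCircle =
      fourier n τ * fourierCoeff F n := by
    rw [fourierCoeff, ← integral_const_mul, ← integral_add_right_eq_self
      (fun x : AddCircle T => fourier n τ * (fourier (-n) x • F x)) τ]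
    refine integral_congr_ae (ae_of_all _ fun x => ?_)
    have : fourier (-n) (x + τ) = fourier (-n) x * fourier (-n) τ := by
      simp only [fourier_apply, smul_add, AddCircle.toCircle_add, Circle.coe_mul]
    have h2 : fourier n τ * fourier (-n) τ = 1 := by
      rw [← fourier_add, add_neg_cancel, fourier_zero]
    simp only [smul_eq_mul, this]
    linear_combination (-(fourier (-n) x * F (x + τ))) * h2
  have hc : Continuous fun x : AddCircle T => fourier (-n) x := (fourier (-n)).continuous
  rw [sub_mul, one_mul, ← h1, fourierCoeff, fourierCoeff, ← integral_sub]
  · simp only [smul_sub]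
  · exact hint _ (by fun_prop)
  · exact hint _ (by fun_prop)

lemma norm_fourier_sub_one_sq (n : ℤ) (τ : ℝ) :
    ‖(fourier n (τ : AddCircle (2 * Real.pi)) : ℂ) - 1‖ ^ 2 = 2 * (1 - Real.cos (n * τ)) := by
  have h : (fourier n (τ : AddCircle (2 * Real.pi)) : ℂ) =
      Complex.exp (Complex.I * ((n * τ : ℝ) : ℂ)) := by
    rw [fourier_coe_apply]
    congr 1
    have := Real.pi_ne_zero
    push_cast
    field_simp
  rw [h, Complex.norm_exp_I_mul_ofReal_sub_one, Real.norm_eq_abs, sq_abs, mul_pow,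
    Real.sin_sq_eq_half_sub, mul_div_cancel₀ _ two_ne_zero]
  ring

lemma one_sub_cos_div_nonneg {τ : ℝ} (hτ : 0 < τ) (s : ℝ) :
    0 ≤ (1 - Real.cos τ) / τ ^ (1 + 2 * s) :=
  div_nonneg (by linarith [Real.cos_le_one τ]) (Real.rpow_nonneg hτ.le _)

/-- Rescaling by `|n|` produces the factor `|n|^(2s)` and the integration range `(0, |n| π)`. For `n
≠ 0` this contains `(0, π)`, and the integrand is nonnegative. -/
lemma abs_rpow_mul_le_lintegral_one_sub_cos {s : ℝ} (h0 : 0 < s) (hs : s < 1) (n : ℤ) :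
    ENNReal.ofReal (|(n : ℝ)| ^ (2 * s) *
        ∫ τ in (0 : ℝ)..Real.pi, (1 - Real.cos τ) / τ ^ (1 + 2 * s)) ≤
      ∫⁻ τ in Ioo 0 Real.pi, ENNReal.ofReal ((1 - Real.cos (n * τ)) / τ ^ (1 + 2 * s)) := by
  have hπ := Real.pi_pos
  rcases eq_or_ne n 0 with rfl | hn
  · simp [Real.zero_rpow (show 2 * s ≠ 0 by linarith)]
  have hm1 : (1 : ℝ) ≤ |(n : ℝ)| := by exact_mod_cast Int.one_le_abs hn
  set m : ℝ := |(n : ℝ)| with hm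
  have hm0 : 0 < m := by linarith
  set f : ℝ → ℝ := fun τ => (1 - Real.cos τ) / τ ^ (1 + 2 * s) with hf
  have hfi : ∀ b, 0 ≤ b → IntervalIntegrable f volume 0 b := fun b hb =>
    intervalIntegrable_one_sub_cos_div hs hb
  have e1 : ∀ τ ∈ Ioo 0 Real.pi, (1 - Real.cos (n * τ)) / τ ^ (1 + 2 * s) =
      m ^ (1 + 2 * s) * f (m * τ) := by
    intro τ hτ
    have : Real.cos (n * τ) = Real.cos (m * τ) := by
      rw [← Real.cos_abs (n * τ), abs_mul, abs_of_pos hτ.1]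
    rw [hf, this]
    simp only
    rw [Real.mul_rpow hm0.le hτ.1.le]
    have := Real.rpow_pos_of_pos hm0 (1 + 2 * s)
    have := Real.rpow_pos_of_pos hτ.1 (1 + 2 * s)
    field_simp
  have hgi : IntervalIntegrable (fun τ => m ^ (1 + 2 * s) * f (m * τ)) volume 0 Real.pi := by
    refine IntervalIntegrable.const_mul ?_ _
    have := (hfi (m * Real.pi) (by positivity)).comp_mul_left (c := m)
    simpa [hm0.ne'] using this
  have hcv : ∫ τ in (0 : ℝ)..Real.pi, m ^ (1 + 2 * s) * f (m * τ) =
      m ^ (2 * s) * ∫ τ in (0 : ℝ)..(m * Real.pi), f τ := by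
    rw [intervalIntegral.integral_const_mul, intervalIntegral.integral_comp_mul_left _ hm0.ne',
      mul_zero, smul_eq_mul, ← mul_assoc, Real.rpow_add hm0, Real.rpow_one]
    field_simp
  calc ENNReal.ofReal (m ^ (2 * s) * ∫ τ in (0 : ℝ)..Real.pi, f τ)
      ≤ ENNReal.ofReal (∫ τ in (0 : ℝ)..Real.pi, m ^ (1 + 2 * s) * f (m * τ)) := by
        rw [hcv]
        refine ENNReal.ofReal_le_ofReal (mul_le_mul_of_nonneg_left ?_ (by positivity))
        refine intervalIntegral.integral_mono_interval le_rfl hπ.le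
          (le_mul_of_one_le_left hπ.le hm1) ?_ (hfi _ (by positivity))
        filter_upwards [ae_restrict_mem measurableSet_Ioc] with τ hτ
        exact one_sub_cos_div_nonneg hτ.1 s
    _ = ∫⁻ τ in Ioc 0 Real.pi, ENNReal.ofReal (m ^ (1 + 2 * s) * f (m * τ)) := by
        rw [intervalIntegral.integral_of_le hπ.le]
        refine ofReal_integral_eq_lintegral_ofReal
          ((intervalIntegrable_iff_integrableOn_Ioc_of_le hπ.le).1 hgi) ?_
        filter_upwards [ae_restrict_mem measurableSet_Ioc] with τ hτ
        exact mul_nonneg (by positivity) (one_sub_cos_div_nonneg (mul_pos hm0 hτ.1) s)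
    _ = _ := by
        rw [← restrict_Ioo_eq_restrict_Ioc]
        exact setLIntegral_congr_fun measurableSet_Ioo fun τ hτ => by simp only [e1 τ hτ]

/-- **Fractional Poincaré inequality on the circle** for functions vanishing at a point. -/
theorem circle_poincare {s : ℝ} (h0 : 1 / 2 < s) (hs : s < 1) {f : AddCircle (2 * Real.pi) → ℝ}
    (hf : Continuous f) {x₀ : AddCircle (2 * Real.pi)} (hx₀ : f x₀ = 0) :
    ENNReal.ofReal (constC1 s) * ∫⁻ x, ENNReal.ofReal (f x ^ 2) ≤
      ENNReal.ofReal (constC2 s) * ∫⁻ τ in Ioo 0 Real.pi, ∫⁻ x : AddCircle (2 * Real.pi),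
        ENNReal.ofReal (2 * (f (x + (τ : ℝ)) - f x) ^ 2 / τ ^ (1 + 2 * s)) := by
  have hπ := Real.pi_pos
  let F : C(AddCircle (2 * Real.pi), ℂ) := ⟨fun x => (f x : ℂ), by fun_prop⟩
  have hF : ∀ x, ‖F x‖ ^ 2 = f x ^ 2 := fun x => by
    show ‖((f x : ℝ) : ℂ)‖ ^ 2 = _
    rw [Complex.norm_real, Real.norm_eq_abs, sq_abs]
  set c := fourierCoeff F with hc
  set S := ∑' n : ℤ, ENNReal.ofReal (|(n : ℝ)| ^ (2 * s) * ‖c n‖ ^ 2) with hS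
  have hπ2 : 0 ≤ 2 * Real.pi := by positivity
  -- Both sides are compared with the homogeneous sum `S`: the zero of `f` serves for the upper
  -- bound on the L² norm, and the lower bound on the energy is `hR`.
  have hL : ∫⁻ x, ENNReal.ofReal (f x ^ 2) ≤ ENNReal.ofReal (constC2 s) * S := by
    simp_rw [← hF]
    rw [lintegral_norm_sq_eq_tsum_fourierCoeff, constC2, ENNReal.ofReal_mul hπ2, mul_assoc]
    refine mul_le_mul_right (tsum_sq_le_of_tsum_mul_eq_zero h0 (w := fun n => fourier n x₀)
      (fun n => ?_) fun hsum => ?_) _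
    · rw [fourier_apply]
      exact Circle.norm_coe _
    · have := has_pointwise_sum_fourier_series_of_summable hsum x₀
      simpa [F, hx₀] using this.tsum_eq
  -- The factor `8π` is `2 · 2π · 2`: the 2 in the energy, the length of the circle, and `|e^(inτ) -
  -- 1|² = 2 (1 - cos nτ)`.
  have hinner : ∀ τ ∈ Ioo 0 Real.pi, ∫⁻ x : AddCircle (2 * Real.pi),
        ENNReal.ofReal (2 * (f (x + (τ : ℝ)) - f x) ^ 2 / τ ^ (1 + 2 * s)) =
      ∑' n : ℤ, ENNReal.ofReal (8 * Real.pi * ‖c n‖ ^ 2) *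
        ENNReal.ofReal ((1 - Real.cos (n * τ)) / τ ^ (1 + 2 * s)) := by
    intro τ hτ
    have hp := Real.rpow_pos_of_pos hτ.1 (1 + 2 * s)
    let G : C(AddCircle (2 * Real.pi), ℂ) := ⟨fun x => F (x + (τ : ℝ)) - F x, by fun_prop⟩
    have hG : ∀ x, ENNReal.ofReal (2 * (f (x + (τ : ℝ)) - f x) ^ 2 / τ ^ (1 + 2 * s)) =
        ENNReal.ofReal (2 / τ ^ (1 + 2 * s)) * ENNReal.ofReal (‖G x‖ ^ 2) := fun x => by
      have : ‖G x‖ ^ 2 = (f (x + (τ : ℝ)) - f x) ^ 2 := by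
        show ‖((f (x + (τ : ℝ)) : ℝ) : ℂ) - ((f x : ℝ) : ℂ)‖ ^ 2 = _
        rw [← Complex.ofReal_sub, Complex.norm_real, Real.norm_eq_abs, sq_abs]
      rw [← ENNReal.ofReal_mul (by positivity), this]
      congr 1
      ring
    simp_rw [hG]
    rw [lintegral_const_mul' _ _ ENNReal.ofReal_ne_top, lintegral_norm_sq_eq_tsum_fourierCoeff,
      ← mul_assoc, ← ENNReal.ofReal_mul (by positivity), ← ENNReal.tsum_mul_left]
    refine tsum_congr fun n => ?_
    have : fourierCoeff G n = (fourier n (τ : AddCircle (2 * Real.pi)) - 1) * c n :=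
      fourierCoeff_translate_sub F _ n
    rw [← ENNReal.ofReal_mul (by positivity), ← ENNReal.ofReal_mul (by positivity), this, norm_mul,
      mul_pow, norm_fourier_sub_one_sq]
    congr 1
    field_simp
    ring
  have hR : ENNReal.ofReal (constC1 s) * S ≤ ∫⁻ τ in Ioo 0 Real.pi,
      ∫⁻ x : AddCircle (2 * Real.pi),
        ENNReal.ofReal (2 * (f (x + (τ : ℝ)) - f x) ^ 2 / τ ^ (1 + 2 * s)) := by
    rw [setLIntegral_congr_fun measurableSet_Ioo hinner, lintegral_tsum, hS,
      ← ENNReal.tsum_mul_left]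
    · refine ENNReal.tsum_le_tsum fun n => ?_
      rw [lintegral_const_mul' _ _ ENNReal.ofReal_ne_top]
      refine le_trans (le_of_eq ?_)
        (mul_le_mul_right (abs_rpow_mul_le_lintegral_one_sub_cos (by linarith) hs n) _)
      rw [← ENNReal.ofReal_mul (constC1_pos hs).le, ← ENNReal.ofReal_mul (by positivity), constC1]
      congr 1
      ring
    · intro n
      refine Measurable.aemeasurable (Measurable.const_mul (Measurable.ennreal_ofReal ?_) _)
      exact (measurable_const.sub (Real.measurable_cos.comp (measurable_id.const_mul _))).div
        (measurable_id.pow_const _)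
  calc ENNReal.ofReal (constC1 s) * ∫⁻ x, ENNReal.ofReal (f x ^ 2)
      ≤ ENNReal.ofReal (constC1 s) * (ENNReal.ofReal (constC2 s) * S) := by gcongr
    _ = ENNReal.ofReal (constC2 s) * (ENNReal.ofReal (constC1 s) * S) := by ring
    _ ≤ _ := by gcongr

end Circle

/-! ### Polar coordinates -/

/-- The point of the plane with polar coordinates `(ρ, θ)`. -/
def polarPt (ρ θ : ℝ) : ℂ := ρ * (Real.cos θ + Real.sin θ * Complex.I)

lemma continuous_polarPt : Continuous fun p : ℝ × ℝ => polarPt p.1 p.2 := by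
  unfold polarPt
  fun_prop

lemma measurable_polarPt_comp {α : Type*} [MeasurableSpace α] {a b : α → ℝ} (ha : Measurable a)
    (hb : Measurable b) : Measurable fun x => polarPt (a x) (b x) :=
  continuous_polarPt.measurable.comp (ha.prodMk hb)

lemma polarPt_periodic (ρ : ℝ) : Function.Periodic (polarPt ρ) (2 * Real.pi) := fun θ => by
  simp [polarPt]

lemma norm_polarPt {ρ : ℝ} (hρ : 0 ≤ ρ) (θ : ℝ) : ‖polarPt ρ θ‖ = ρ := by
  have := Complex.norm_polarCoord_symm (ρ, θ)
  rwa [Complex.polarCoord_symm_apply, abs_of_nonneg hρ] at this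

lemma norm_polarPt_sub_sq (ρ φ t θ : ℝ) :
    ‖polarPt ρ φ - polarPt t θ‖ ^ 2 = (ρ - t) ^ 2 + 2 * ρ * t * (1 - Real.cos (φ - θ)) := by
  rw [← Complex.normSq_eq_norm_sq, Complex.normSq_apply, Real.cos_sub]
  simp only [polarPt, Complex.sub_re, Complex.sub_im, Complex.mul_re, Complex.mul_im,
    Complex.ofReal_re, Complex.ofReal_im, Complex.add_re, Complex.add_im, Complex.I_re,
    Complex.I_im]
  have h1 := Real.sin_sq_add_cos_sq φ
  have h2 := Real.sin_sq_add_cos_sq θ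
  linear_combination ρ ^ 2 * h1 + t ^ 2 * h2

lemma lintegral_ball_eq_polar {F : ℂ → ℝ≥0∞} (hF : Measurable F) (R : ℝ) :
    ∫⁻ z in Metric.ball 0 R, F z =
      ∫⁻ ρ in Ioo 0 R, ∫⁻ θ in Ioo (-Real.pi) Real.pi, ENNReal.ofReal ρ * F (polarPt ρ θ) := by
  have hm : Measurable ((Metric.ball (0 : ℂ) R).indicator F) :=
    hF.indicator Metric.isOpen_ball.measurableSet
  have hpt : Measurable fun p : ℝ × ℝ => polarPt p.1 p.2 := continuous_polarPt.measurable
  rw [← lintegral_indicator Metric.isOpen_ball.measurableSet,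
    ← Complex.lintegral_comp_polarCoord_symm, polarCoord_target, Measure.volume_eq_prod,
    ← Measure.prod_restrict]
  have hcongr : ∀ p : ℝ × ℝ, ENNReal.ofReal p.1 •
      (Metric.ball (0 : ℂ) R).indicator F (Complex.polarCoord.symm p) =
      ENNReal.ofReal p.1 * (Metric.ball (0 : ℂ) R).indicator F (polarPt p.1 p.2) := fun p => by
    rw [smul_eq_mul, Complex.polarCoord_symm_apply, polarPt]
  simp_rw [hcongr]
  rw [lintegral_prod _ (Measurable.aemeasurable (by fun_prop))]
  rw [← lintegral_indicator measurableSet_Ioi, ← lintegral_indicator measurableSet_Ioo]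
  congr 1
  ext ρ
  by_cases h0 : 0 < ρ
  · by_cases h1 : ρ < R
    · rw [indicator_of_mem (show ρ ∈ Ioi 0 from h0),
        indicator_of_mem (show ρ ∈ Ioo 0 R from ⟨h0, h1⟩)]
      refine lintegral_congr fun θ => ?_
      rw [indicator_of_mem]
      simpa [norm_polarPt h0.le] using h1
    · rw [indicator_of_mem (show ρ ∈ Ioi 0 from h0), indicator_of_notMem (fun h => h1 h.2)]
      have : ∀ θ, (Metric.ball (0 : ℂ) R).indicator F (polarPt ρ θ) = 0 := fun θ =>
        indicator_of_notMem (by simpa [norm_polarPt h0.le] using h1) _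
      simp [this]
  · rw [indicator_of_notMem (show ρ ∉ Ioi 0 from h0), indicator_of_notMem fun h => h0 h.1]

lemma lintegral_period_eq_addCircle {F : ℝ → ℝ≥0∞} (hF : Function.Periodic F (2 * Real.pi)) :
    ∫⁻ θ in Ioo (-Real.pi) Real.pi, F θ = ∫⁻ x : AddCircle (2 * Real.pi), hF.lift x := by
  rw [← AddCircle.lintegral_preimage (2 * Real.pi) (-Real.pi),
    show -Real.pi + 2 * Real.pi = Real.pi by ring, restrict_Ioo_eq_restrict_Ioc]
  rfl

lemma lintegral_period_add {F : ℝ → ℝ≥0∞} (hF : Function.Periodic F (2 * Real.pi)) (h : ℝ) :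
    ∫⁻ θ in Ioo (-Real.pi) Real.pi, F (θ + h) = ∫⁻ θ in Ioo (-Real.pi) Real.pi, F θ := by
  have hF' : Function.Periodic (fun θ => F (θ + h)) (2 * Real.pi) := fun θ => by
    simp only
    rw [show θ + 2 * Real.pi + h = θ + h + 2 * Real.pi by ring, hF]
  rw [lintegral_period_eq_addCircle hF, lintegral_period_eq_addCircle hF',
    ← lintegral_add_right_eq_self hF.lift (h : AddCircle (2 * Real.pi))]
  refine lintegral_congr fun x => ?_
  induction x using QuotientAddGroup.induction_on with
  | H x => rfl

lemma setLIntegral_preimage_mul_left {c : ℝ} (hc : c ≠ 0) (k : ℝ → ℝ≥0∞) (S : Set ℝ) :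
    ∫⁻ x in (c * ·) ⁻¹' S, k (c * x) = ENNReal.ofReal |c⁻¹| * ∫⁻ x in S, k x := by
  have he := (Homeomorph.mulLeft₀ c hc).measurableEmbedding
  have h1 := he.restrict_map volume S
  have h2 := he.lintegral_map (μ := volume.restrict ((c * ·) ⁻¹' S)) k
  simp only [Homeomorph.coe_mulLeft₀] at h1 h2
  rw [← h2, ← h1, Real.map_volume_mul_left hc, Measure.restrict_smul, lintegral_smul_measure,
    smul_eq_mul]

/-- The substitutions `h = τ/2` and `h = -τ/2`, each with Jacobian factor 2, map onto the disjoint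
intervals `(0, π/2)` and `(-π/2, 0)`, which together fit into one period. -/
lemma lintegral_half_angle_add_le {k : ℝ → ℝ≥0∞} (hk : Function.Periodic k (2 * Real.pi))
    (hkm : Measurable k) (θ : ℝ) :
    ∫⁻ τ in Ioo 0 Real.pi, (k (θ + τ / 2) + k (θ - τ / 2)) ≤
      2 * ∫⁻ φ in Ioo (-Real.pi) Real.pi, k φ := by
  have hπ := Real.pi_pos
  have h1 : ∫⁻ τ in Ioo 0 Real.pi, k (θ + τ / 2) =
      2 * ∫⁻ h in Ioo 0 (Real.pi / 2), k (h + θ) := by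
    have := setLIntegral_preimage_mul_left (c := 1 / 2) (by norm_num) (fun h => k (h + θ))
      (Ioo 0 (Real.pi / 2))
    rw [show ((1 / 2 : ℝ) * ·) ⁻¹' Ioo 0 (Real.pi / 2) = Ioo 0 Real.pi by
      ext x; simp only [mem_preimage, mem_Ioo]
      constructor <;> rintro ⟨h1, h2⟩ <;> constructor <;> linarith] at this
    rw [show ENNReal.ofReal |(1 / 2 : ℝ)⁻¹| = 2 by norm_num] at this
    rw [← this]
    refine lintegral_congr fun τ => ?_
    congr 1; ring
  have h2 : ∫⁻ τ in Ioo 0 Real.pi, k (θ - τ / 2) =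
      2 * ∫⁻ h in Ioo (-(Real.pi / 2)) 0, k (h + θ) := by
    have := setLIntegral_preimage_mul_left (c := -(1 / 2)) (by norm_num) (fun h => k (h + θ))
      (Ioo (-(Real.pi / 2)) 0)
    rw [show ((-(1 / 2) : ℝ) * ·) ⁻¹' Ioo (-(Real.pi / 2)) 0 = Ioo 0 Real.pi by
      ext x; simp only [mem_preimage, mem_Ioo]
      constructor <;> rintro ⟨h1, h2⟩ <;> constructor <;> linarith] at this
    rw [show ENNReal.ofReal |(-(1 / 2) : ℝ)⁻¹| = 2 by norm_num] at this
    rw [← this]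
    refine lintegral_congr fun τ => ?_
    congr 1; ring
  rw [lintegral_add_left (f := fun τ => k (θ + τ / 2)) (hkm.comp (by fun_prop)), h1, h2, ← mul_add, ← lintegral_period_add hk θ,
    ← lintegral_union measurableSet_Ioo]
  · refine mul_le_mul_right (lintegral_mono_set ?_) _
    rintro x (⟨h1, h2⟩ | ⟨h1, h2⟩) <;> constructor <;> linarith
  · rw [Set.disjoint_left]
    rintro x ⟨h1, -⟩ ⟨-, h2⟩
    linarith

/-! ### Restriction of the Gagliardo energy to circles -/

/-- The base `(1/4 + σ) / 4` is below 1, so the worst exponent is `s = 1/2`; squaring then leaves a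
cubic inequality in `σ` on `[1/5, 1]`. -/
lemma quarter_add_rpow_le {s σ : ℝ} (hs : 1 / 2 ≤ s) (h0 : 1 / 5 ≤ σ) (h1 : σ ≤ 1) :
    4 * (1 / 4 + σ) ^ (1 + s) ≤ 15 / 4 * σ * 4 ^ s := by
  have hx : 0 < 1 / 4 + σ := by linarith
  have h4 : ((1 / 4 + σ) / 4) ^ s ≤ Real.sqrt ((1 / 4 + σ) / 4) := by
    rw [Real.sqrt_eq_rpow]
    exact Real.rpow_le_rpow_of_exponent_ge (by positivity) (by linarith) hs
  have h5 : (1 / 4 + σ) * Real.sqrt ((1 / 4 + σ) / 4) ≤ 15 / 16 * σ := by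
    refine abs_le_of_sq_le_sq' ?_ (by positivity) |>.2
    rw [mul_pow, Real.sq_sqrt (by positivity)]
    nlinarith [mul_nonneg (sub_nonneg.2 h0) (sub_nonneg.2 h1),
      mul_nonneg (mul_nonneg (sub_nonneg.2 h0) (sub_nonneg.2 h1)) (sub_nonneg.2 h0)]
  have h6 : (1 / 4 + σ) ^ s = ((1 / 4 + σ) / 4) ^ s * 4 ^ s := by
    rw [← Real.mul_rpow (by positivity) (by norm_num), div_mul_cancel₀ _ (by norm_num)]
  have h7 : (0 : ℝ) < 4 ^ s := by positivity
  rw [Real.rpow_add hx, Real.rpow_one, h6]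
  nlinarith [mul_le_mul_of_nonneg_left h4 hx.le]

/-- Comparison of the planar kernel with the averaged angular one. -/
lemma angular_kernel_le {s ρ τ t φ θ : ℝ} (hs : 1 / 2 ≤ s) (hρ : 0 < ρ) (hτ0 : 0 < τ)
    (hτπ : τ < Real.pi) (ht : t ∈ Ioo (ρ * (1 - τ / 4)) ρ)
    (hφ : Real.cos (φ - θ) = Real.cos (τ / 2)) :
    4 / (ρ * τ) * (4 / τ ^ (1 + 2 * s)) ≤
      15 / 4 * ρ ^ (2 * s) * (t / ‖polarPt ρ φ - polarPt t θ‖ ^ (2 + 2 * s)) := by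
  have hπ := Real.pi_lt_d2
  obtain ⟨σ, rfl⟩ : ∃ σ, t = ρ * σ := ⟨t / ρ, by field_simp⟩
  obtain ⟨h, rfl⟩ : ∃ h, τ = 2 * h := ⟨τ / 2, by ring⟩
  have hh : 0 < h := by linarith
  have hσ0 : 1 - h / 2 < σ := by
    have := lt_of_mul_lt_mul_left ht.1 hρ.le; linarith
  have hσ1 : σ < 1 := by
    have := ht.2; nlinarith
  have hσ : 1 / 5 ≤ σ := by linarith
  -- The bound `σ ≥ 1/5` used `1 - π/4 > 1/5`; it keeps the intermediate points away from the
  -- centre.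
  set N := ‖polarPt ρ φ - polarPt (ρ * σ) θ‖ with hN
  have hNsq : N ^ 2 = (ρ - ρ * σ) ^ 2 + 2 * ρ * (ρ * σ) * (1 - Real.cos h) := by
    rw [hN, norm_polarPt_sub_sq, hφ, mul_div_cancel_left₀ _ two_ne_zero]
  have hcos0 := Real.cos_le_one h
  have hcos := Real.one_sub_sq_div_two_le_cos (x := h)
  have hNpos : 0 < N := by
    refine lt_of_le_of_ne (norm_nonneg _) fun h0 => ?_
    rw [← h0] at hNsq
    have : 0 < (ρ - ρ * σ) ^ 2 := by
      have : 0 < ρ - ρ * σ := by nlinarith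
      positivity
    have : 0 ≤ 2 * ρ * (ρ * σ) * (1 - Real.cos h) :=
      mul_nonneg (by positivity) (by linarith)
    nlinarith
  -- The radial gap satisfies `1 - σ ≤ h/2`, giving the `1/4`; the angular part uses `1 - cos h ≤ h²
  -- / 2`, giving the `σ`.
  have hN2 : N ^ 2 ≤ (ρ * h) ^ 2 * (1 / 4 + σ) := by
    have e1 : (1 - σ) ^ 2 ≤ (h / 2) ^ 2 := by
      apply pow_le_pow_left₀ <;> linarith
    have e2 : σ * (1 - Real.cos h) ≤ σ * (h ^ 2 / 2) := by gcongr; linarith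
    have e3 : 0 < ρ ^ 2 := by positivity
    rw [hNsq]
    nlinarith
  have hNp : N ^ (2 + 2 * s) ≤ (ρ * h) ^ (2 + 2 * s) * (1 / 4 + σ) ^ (1 + s) := by
    have e : ∀ x : ℝ, 0 < x → x ^ (2 + 2 * s) = (x ^ 2) ^ (1 + s) := fun x hx => by
      rw [← Real.rpow_two, ← Real.rpow_mul hx.le]; ring_nf
    rw [e N hNpos, e (ρ * h) (by positivity), ← Real.mul_rpow (by positivity) (by positivity)]
    exact Real.rpow_le_rpow (by positivity) hN2 (by linarith)
  have key := quarter_add_rpow_le hs hσ hσ1.le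
  have hNpp : 0 < N ^ (2 + 2 * s) := by positivity
  rw [← mul_div_assoc _ (ρ * σ), le_div_iff₀ hNpp]
  have e1 : (2 * h) ^ (1 + 2 * s) = 2 * h * (4 ^ s * h ^ (2 * s)) := by
    rw [Real.rpow_add (by positivity), Real.rpow_one, Real.mul_rpow (by norm_num) hh.le,
      Real.rpow_mul (by norm_num)]
    norm_num
  have e2 : (ρ * h) ^ (2 + 2 * s) = ρ ^ 2 * h ^ 2 * (ρ ^ (2 * s) * h ^ (2 * s)) := by
    rw [Real.rpow_add (by positivity), Real.rpow_two, mul_pow, Real.mul_rpow hρ.le hh.le]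
  have h4s : (0 : ℝ) < 4 ^ s := by positivity
  have hhs : 0 < h ^ (2 * s) := by positivity
  have hρs : 0 < ρ ^ (2 * s) := by positivity
  calc 4 / (ρ * (2 * h)) * (4 / (2 * h) ^ (1 + 2 * s)) * N ^ (2 + 2 * s)
      ≤ 4 / (ρ * (2 * h)) * (4 / (2 * h) ^ (1 + 2 * s)) *
          ((ρ * h) ^ (2 + 2 * s) * (1 / 4 + σ) ^ (1 + s)) := by gcongr
    _ = ρ * ρ ^ (2 * s) * (4 * (1 / 4 + σ) ^ (1 + s)) / 4 ^ s := by
        rw [e1, e2]; field_simp; norm_num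
    _ ≤ ρ * ρ ^ (2 * s) * (15 / 4 * σ * 4 ^ s) / 4 ^ s := by gcongr
    _ = 15 / 4 * ρ ^ (2 * s) * (ρ * σ) := by field_simp

/-- The integrand of the Gagliardo energy in the plane. -/
def pairEnergy (s : ℝ) (v : ℂ → ℝ) (z w : ℂ) : ℝ≥0∞ :=
  ENNReal.ofReal ((v z - v w) ^ 2 / ‖z - w‖ ^ (2 + 2 * s))

lemma measurable_pairEnergy_comp {α : Type*} [MeasurableSpace α] (s : ℝ) {v : ℂ → ℝ}
    (hv : Measurable v) {a b : α → ℂ} (ha : Measurable a) (hb : Measurable b) :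
    Measurable fun x => pairEnergy s v (a x) (b x) :=
  ((((hv.comp ha).sub (hv.comp hb)).pow_const 2).div
    ((ha.sub hb).norm.pow_const _)).ennreal_ofReal

lemma lintegral_rotate {α β γ : Type*} [MeasurableSpace α] [MeasurableSpace β] [MeasurableSpace γ]
    (μ : Measure α) (ν : Measure β) (κ : Measure γ) [SFinite μ] [SFinite ν] [SFinite κ]
    {H : α → β → γ → ℝ≥0∞} (hH : Measurable fun p : α × β × γ => H p.1 p.2.1 p.2.2) :
    ∫⁻ a, ∫⁻ b, ∫⁻ c, H a b c ∂κ ∂ν ∂μ = ∫⁻ b, ∫⁻ c, ∫⁻ a, H a b c ∂μ ∂κ ∂ν := by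
  rw [lintegral_lintegral_swap]
  · refine lintegral_congr fun b => lintegral_lintegral_swap (Measurable.aemeasurable ?_)
    exact hH.comp (f := fun p : α × γ => (p.1, b, p.2)) (by fun_prop)
  · refine Measurable.aemeasurable ?_
    exact Measurable.lintegral_prod_right' (f := fun q : (α × β) × γ => H q.1.1 q.1.2 q.2)
      (hH.comp (f := fun q : (α × β) × γ => (q.1.1, q.1.2, q.2)) (by fun_prop))

/-- The intermediate point has the middle angle `θ + τ/2`, so both endpoints of the arc are at angle
`τ/2` from it and the same kernel bound serves twice. The factor `4 / (ρ τ)` is the reciprocal of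
the length of the interval of admissible `t`. -/
lemma sq_sub_div_le_pairEnergy {s ρ τ t θ : ℝ} (hs : 1 / 2 ≤ s) (hρ : 0 < ρ) (hτ0 : 0 < τ)
    (hτπ : τ < Real.pi) (ht : t ∈ Ioo (ρ * (1 - τ / 4)) ρ) (v : ℂ → ℝ) :
    ENNReal.ofReal (4 / (ρ * τ)) *
        ENNReal.ofReal (2 * (v (polarPt ρ (θ + τ)) - v (polarPt ρ θ)) ^ 2 / τ ^ (1 + 2 * s)) ≤
      ENNReal.ofReal (15 / 4 * ρ ^ (2 * s)) * (ENNReal.ofReal t *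
        (pairEnergy s v (polarPt ρ (θ + τ)) (polarPt t (θ + τ / 2)) +
          pairEnergy s v (polarPt ρ θ) (polarPt t (θ + τ / 2)))) := by
  have hπ := Real.pi_lt_four
  have ht0 : 0 ≤ t := by
    have : 0 < ρ * (1 - τ / 4) := mul_pos hρ (by linarith)
    linarith [ht.1]
  have hk1 := angular_kernel_le (φ := θ + τ) (θ := θ + τ / 2) hs hρ hτ0 hτπ ht
    (by congr 1; ring)
  have hk2 := angular_kernel_le (φ := θ) (θ := θ + τ / 2) hs hρ hτ0 hτπ ht
    (by rw [← Real.cos_neg]; congr 1; ring)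
  set a := v (polarPt ρ (θ + τ))
  set b := v (polarPt ρ θ)
  set c := v (polarPt t (θ + τ / 2))
  set N₁ := ‖polarPt ρ (θ + τ) - polarPt t (θ + τ / 2)‖ ^ (2 + 2 * s) with hN₁
  set N₂ := ‖polarPt ρ θ - polarPt t (θ + τ / 2)‖ ^ (2 + 2 * s) with hN₂
  have hN₁0 : 0 ≤ N₁ := by positivity
  have hN₂0 : 0 ≤ N₂ := by positivity
  have hab : (a - b) ^ 2 ≤ 2 * (a - c) ^ 2 + 2 * (b - c) ^ 2 := by
    nlinarith [sq_nonneg ((a - c) + (b - c))]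
  rw [pairEnergy, pairEnergy, ← ENNReal.ofReal_add (by positivity) (by positivity),
    ← ENNReal.ofReal_mul (by positivity), ← ENNReal.ofReal_mul ht0,
    ← ENNReal.ofReal_mul (by positivity)]
  refine ENNReal.ofReal_le_ofReal ?_
  calc 4 / (ρ * τ) * (2 * (a - b) ^ 2 / τ ^ (1 + 2 * s))
      ≤ 4 / (ρ * τ) * (2 * (2 * (a - c) ^ 2 + 2 * (b - c) ^ 2) / τ ^ (1 + 2 * s)) := by gcongr
    _ = 4 / (ρ * τ) * (4 / τ ^ (1 + 2 * s)) * (a - c) ^ 2 +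
        4 / (ρ * τ) * (4 / τ ^ (1 + 2 * s)) * (b - c) ^ 2 := by ring
    _ ≤ 15 / 4 * ρ ^ (2 * s) * (t / N₁) * (a - c) ^ 2 +
        15 / 4 * ρ ^ (2 * s) * (t / N₂) * (b - c) ^ 2 := by gcongr
    _ = _ := by ring

/-- The fractional energy on a circle is controlled by the interaction energy of that circle with
the disc that it bounds. -/
lemma circle_energy_le {s ρ : ℝ} (hs : 1 / 2 ≤ s) (hρ : 0 < ρ) {v : ℂ → ℝ} (hv : Continuous v) :
    ∫⁻ τ in Ioo 0 Real.pi, ∫⁻ θ in Ioo (-Real.pi) Real.pi,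
        ENNReal.ofReal (2 * (v (polarPt ρ (θ + τ)) - v (polarPt ρ θ)) ^ 2 / τ ^ (1 + 2 * s)) ≤
      ENNReal.ofReal (15 / 2 * ρ ^ (2 * s)) * ∫⁻ φ in Ioo (-Real.pi) Real.pi,
        ∫⁻ t in Ioo 0 ρ, ∫⁻ θ in Ioo (-Real.pi) Real.pi,
          ENNReal.ofReal t * pairEnergy s v (polarPt ρ φ) (polarPt t θ) := by
  have hπ := Real.pi_pos
  have hπ4 := Real.pi_lt_four
  set C := ENNReal.ofReal (15 / 4 * ρ ^ (2 * s)) with hC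
  have hE : ∀ {α : Type} [MeasurableSpace α] {a b c : α → ℝ}, Measurable a → Measurable b →
      Measurable c → Measurable fun x =>
        pairEnergy s v (polarPt ρ (a x)) (polarPt (b x) (c x)) := fun ha hb hc =>
    measurable_pairEnergy_comp s hv.measurable (measurable_polarPt_comp measurable_const ha)
      (measurable_polarPt_comp hb hc)
  have hshift : ∀ (α β γ t : ℝ), ∫⁻ θ in Ioo (-Real.pi) Real.pi, ENNReal.ofReal t *
        pairEnergy s v (polarPt ρ (θ + α)) (polarPt t (θ + β)) =
      ∫⁻ θ in Ioo (-Real.pi) Real.pi, ENNReal.ofReal t *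
        pairEnergy s v (polarPt ρ (θ + (α - β))) (polarPt t θ) := fun α β γ t => by
    rw [← lintegral_period_add (F := fun θ => ENNReal.ofReal t *
        pairEnergy s v (polarPt ρ (θ + (α - β))) (polarPt t θ)) (fun θ => ?_) β]
    · refine lintegral_congr fun θ => ?_
      rw [show θ + β + (α - β) = θ + α by ring]
    · simp only
      rw [show θ + 2 * Real.pi + (α - β) = θ + (α - β) + 2 * Real.pi by ring,
        polarPt_periodic, polarPt_periodic]
  have hslice : ∀ τ ∈ Ioo 0 Real.pi, ∫⁻ θ in Ioo (-Real.pi) Real.pi,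
        ENNReal.ofReal (2 * (v (polarPt ρ (θ + τ)) - v (polarPt ρ θ)) ^ 2 / τ ^ (1 + 2 * s)) ≤
      C * ∫⁻ t in Ioo 0 ρ, ∫⁻ θ in Ioo (-Real.pi) Real.pi, ENNReal.ofReal t *
        (pairEnergy s v (polarPt ρ (θ + τ / 2)) (polarPt t θ) +
          pairEnergy s v (polarPt ρ (θ - τ / 2)) (polarPt t θ)) := by
    rintro τ ⟨hτ0, hτπ⟩
    -- The left side does not depend on `t`, so it equals its average over `J`, an interval of
    -- length `ρ τ / 4`.
    set J := Ioo (ρ * (1 - τ / 4)) ρ with hJ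
    have hJsub : J ⊆ Ioo 0 ρ := Ioo_subset_Ioo_left (by
      have := mul_pos hρ (show 0 < 1 - τ / 4 by linarith)
      linarith)
    have hJvol : ENNReal.ofReal (4 / (ρ * τ)) * volume J = 1 := by
      rw [hJ, Real.volume_Ioo, ← ENNReal.ofReal_mul (by positivity), ← ENNReal.ofReal_one]
      congr 1
      field_simp
      ring
    calc ∫⁻ θ in Ioo (-Real.pi) Real.pi,
          ENNReal.ofReal (2 * (v (polarPt ρ (θ + τ)) - v (polarPt ρ θ)) ^ 2 / τ ^ (1 + 2 * s))
        = ∫⁻ θ in Ioo (-Real.pi) Real.pi, ∫⁻ _ in J, ENNReal.ofReal (4 / (ρ * τ)) *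
          ENNReal.ofReal (2 * (v (polarPt ρ (θ + τ)) - v (polarPt ρ θ)) ^ 2 / τ ^ (1 + 2 * s)) := by
          refine lintegral_congr fun θ => ?_
          rw [setLIntegral_const, mul_right_comm, hJvol, one_mul]
      _ ≤ ∫⁻ θ in Ioo (-Real.pi) Real.pi, ∫⁻ t in Ioo 0 ρ, C * (ENNReal.ofReal t *
          (pairEnergy s v (polarPt ρ (θ + τ)) (polarPt t (θ + τ / 2)) +
            pairEnergy s v (polarPt ρ θ) (polarPt t (θ + τ / 2)))) := by
          refine lintegral_mono fun θ => ?_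
          refine le_trans ?_ (lintegral_mono_set hJsub)
          exact setLIntegral_mono' measurableSet_Ioo fun t ht =>
            sq_sub_div_le_pairEnergy hs hρ hτ0 hτπ ht v
      _ = ∫⁻ t in Ioo 0 ρ, ∫⁻ θ in Ioo (-Real.pi) Real.pi, C * (ENNReal.ofReal t *
          (pairEnergy s v (polarPt ρ (θ + τ)) (polarPt t (θ + τ / 2)) +
            pairEnergy s v (polarPt ρ θ) (polarPt t (θ + τ / 2)))) := by
          refine lintegral_lintegral_swap (Measurable.aemeasurable ?_)
          simp only [Function.uncurry_def]
          refine Measurable.const_mul (Measurable.fun_mul ?_ (Measurable.fun_add ?_ ?_)) _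
          · fun_prop
          · exact hE (by fun_prop) (by fun_prop) (by fun_prop)
          · exact hE (by fun_prop) (by fun_prop) (by fun_prop)
      _ = _ := by
          rw [← lintegral_const_mul' _ _ ENNReal.ofReal_ne_top]
          refine lintegral_congr fun t => ?_
          rw [lintegral_const_mul' _ _ ENNReal.ofReal_ne_top]
          simp only [mul_add]
          rw [lintegral_add_left, lintegral_add_left]
          · congr 2
            · rw [hshift _ _ 0]
              refine lintegral_congr fun θ => ?_
              rw [show θ + (τ - τ / 2) = θ + τ / 2 by ring]
            · have := hshift 0 (τ / 2) 0 t
              simp only [add_zero, zero_sub, ← sub_eq_add_neg] at this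
              exact this
          · exact (hE (by fun_prop) measurable_const (by fun_prop)).const_mul _
          · exact (hE (by fun_prop) measurable_const (by fun_prop)).const_mul _
  calc ∫⁻ τ in Ioo 0 Real.pi, ∫⁻ θ in Ioo (-Real.pi) Real.pi,
        ENNReal.ofReal (2 * (v (polarPt ρ (θ + τ)) - v (polarPt ρ θ)) ^ 2 / τ ^ (1 + 2 * s))
      ≤ ∫⁻ τ in Ioo 0 Real.pi, C * ∫⁻ t in Ioo 0 ρ, ∫⁻ θ in Ioo (-Real.pi) Real.pi,
          ENNReal.ofReal t *
          (pairEnergy s v (polarPt ρ (θ + τ / 2)) (polarPt t θ) +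
            pairEnergy s v (polarPt ρ (θ - τ / 2)) (polarPt t θ)) :=
        setLIntegral_mono' measurableSet_Ioo hslice
    _ = C * ∫⁻ t in Ioo 0 ρ, ∫⁻ θ in Ioo (-Real.pi) Real.pi, ∫⁻ τ in Ioo 0 Real.pi,
          ENNReal.ofReal t *
          (pairEnergy s v (polarPt ρ (θ + τ / 2)) (polarPt t θ) +
            pairEnergy s v (polarPt ρ (θ - τ / 2)) (polarPt t θ)) := by
        rw [lintegral_const_mul' _ _ ENNReal.ofReal_ne_top, lintegral_rotate]
        refine Measurable.fun_mul ?_ (Measurable.fun_add ?_ ?_)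
        · fun_prop
        · exact hE (by fun_prop) (by fun_prop) (by fun_prop)
        · exact hE (by fun_prop) (by fun_prop) (by fun_prop)
    _ ≤ C * ∫⁻ t in Ioo 0 ρ, ∫⁻ θ in Ioo (-Real.pi) Real.pi,
          2 * ∫⁻ φ in Ioo (-Real.pi) Real.pi,
            ENNReal.ofReal t * pairEnergy s v (polarPt ρ φ) (polarPt t θ) := by
        gcongr with t θ
        rw [lintegral_const_mul' _ _ ENNReal.ofReal_ne_top,
          lintegral_const_mul' _ _ ENNReal.ofReal_ne_top, mul_left_comm]
        refine mul_le_mul_right (lintegral_half_angle_add_le (fun φ => ?_) ?_ θ) _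
        · rw [polarPt_periodic]
        · exact hE measurable_id measurable_const measurable_const
    _ = _ := by
        simp only [lintegral_const_mul' _ _ ENNReal.ofNat_ne_top]
        rw [← mul_assoc, ← lintegral_rotate (volume.restrict (Ioo (-Real.pi) Real.pi))
          (volume.restrict (Ioo 0 ρ)) (volume.restrict (Ioo (-Real.pi) Real.pi)) (H := fun φ t θ =>
          ENNReal.ofReal t * pairEnergy s v (polarPt ρ φ) (polarPt t θ))]
        · congr 1
          rw [hC, show (2 : ℝ≥0∞) = ENNReal.ofReal 2 by simp, ← ENNReal.ofReal_mul (by positivity)]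
          congr 1
          ring
        · refine Measurable.mul ?_ (hE ?_ ?_ ?_) <;> fun_prop

/-- **Poincaré inequality on a disc** for functions having a zero on every concentric circle. -/
theorem ball_poincare {s R : ℝ} (h0 : 1 / 2 < s) (hs : s < 1) {v : ℂ → ℝ} (hv : Continuous v)
    (hzero : ∀ ρ ∈ Ioo 0 R, ∃ θ, v (polarPt ρ θ) = 0) :
    ENNReal.ofReal (constC1 s) * ∫⁻ z in Metric.ball 0 R, ENNReal.ofReal (v z ^ 2) ≤
      ENNReal.ofReal (constC2 s) * (ENNReal.ofReal (15 / 2 * R ^ (2 * s)) *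
        ∫⁻ z in Metric.ball 0 R, ∫⁻ w in Metric.ball 0 R, pairEnergy s v z w) := by
  have hcircle : ∀ ρ ∈ Ioo 0 R,
      ENNReal.ofReal (constC1 s) * ∫⁻ θ in Ioo (-Real.pi) Real.pi,
        ENNReal.ofReal (v (polarPt ρ θ) ^ 2) ≤
      ENNReal.ofReal (constC2 s) * (ENNReal.ofReal (15 / 2 * R ^ (2 * s)) *
        ∫⁻ φ in Ioo (-Real.pi) Real.pi, ∫⁻ t in Ioo 0 R, ∫⁻ θ in Ioo (-Real.pi) Real.pi,
          ENNReal.ofReal t * pairEnergy s v (polarPt ρ φ) (polarPt t θ)) := by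
    intro ρ hρ
    obtain ⟨θ₀, hθ₀⟩ := hzero ρ hρ
    have hper : Function.Periodic (fun θ => v (polarPt ρ θ)) (2 * Real.pi) := fun θ => by
      simp only [polarPt_periodic ρ θ]
    have hcont : Continuous hper.lift := by
      refine continuous_coinduced_dom.2 ?_
      exact hv.comp (continuous_polarPt.comp (by fun_prop : Continuous fun θ : ℝ => (ρ, θ)))
    have hP := circle_poincare h0 hs hcont (x₀ := (θ₀ : AddCircle (2 * Real.pi))) hθ₀
    have e1 : ∫⁻ x : AddCircle (2 * Real.pi), ENNReal.ofReal (hper.lift x ^ 2) =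
        ∫⁻ θ in Ioo (-Real.pi) Real.pi, ENNReal.ofReal (v (polarPt ρ θ) ^ 2) := by
      rw [← AddCircle.lintegral_preimage (2 * Real.pi) (-Real.pi),
        show -Real.pi + 2 * Real.pi = Real.pi by ring, restrict_Ioo_eq_restrict_Ioc]
      rfl
    have e2 : ∀ τ : ℝ, ∫⁻ x : AddCircle (2 * Real.pi),
        ENNReal.ofReal (2 * (hper.lift (x + (τ : ℝ)) - hper.lift x) ^ 2 / τ ^ (1 + 2 * s)) =
        ∫⁻ θ in Ioo (-Real.pi) Real.pi, ENNReal.ofReal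
          (2 * (v (polarPt ρ (θ + τ)) - v (polarPt ρ θ)) ^ 2 / τ ^ (1 + 2 * s)) := fun τ => by
      rw [← AddCircle.lintegral_preimage (2 * Real.pi) (-Real.pi),
        show -Real.pi + 2 * Real.pi = Real.pi by ring, restrict_Ioo_eq_restrict_Ioc]
      rfl
    simp only [e1, e2] at hP
    refine hP.trans (mul_le_mul_right ((circle_energy_le h0.le hρ.1 hv).trans ?_) _)
    -- Passing from `ρ` to `R` in the constant and in the inner disc makes the bound uniform over
    -- the circles.
    refine mul_le_mul' (ENNReal.ofReal_le_ofReal ?_) ?_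
    · have := Real.rpow_le_rpow hρ.1.le hρ.2.le (show 0 ≤ 2 * s by linarith)
      linarith
    · exact lintegral_mono fun φ => lintegral_mono_set (Ioo_subset_Ioo_right hρ.2.le)
  have hv2 : Measurable fun z => ENNReal.ofReal (v z ^ 2) :=
    (hv.measurable.pow_const 2).ennreal_ofReal
  have hin : ∀ z, ∫⁻ w in Metric.ball 0 R, pairEnergy s v z w =
      ∫⁻ t in Ioo 0 R, ∫⁻ θ in Ioo (-Real.pi) Real.pi,
        ENNReal.ofReal t * pairEnergy s v z (polarPt t θ) := fun z =>
    lintegral_ball_eq_polar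
      (measurable_pairEnergy_comp s hv.measurable measurable_const measurable_id) R
  have hm : Measurable fun z => ∫⁻ w in Metric.ball 0 R, pairEnergy s v z w :=
    Measurable.lintegral_prod_right' (f := fun p : ℂ × ℂ => pairEnergy s v p.1 p.2)
      (measurable_pairEnergy_comp s hv.measurable measurable_fst measurable_snd)
  rw [lintegral_ball_eq_polar hv2, lintegral_ball_eq_polar hm,
    ← lintegral_const_mul' _ _ ENNReal.ofReal_ne_top,
    ← lintegral_const_mul' _ _ ENNReal.ofReal_ne_top,
    ← lintegral_const_mul' _ _ ENNReal.ofReal_ne_top]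
  refine setLIntegral_mono' measurableSet_Ioo fun ρ hρ => ?_
  simp only [hin, lintegral_const_mul' _ _ ENNReal.ofReal_ne_top]
  calc _ = ENNReal.ofReal ρ * (ENNReal.ofReal (constC1 s) * ∫⁻ θ in Ioo (-Real.pi) Real.pi,
        ENNReal.ofReal (v (polarPt ρ θ) ^ 2)) := by ring
    _ ≤ _ := mul_le_mul_right (hcircle ρ hρ) _
    _ = _ := by
      simp only [lintegral_const_mul' _ _ ENNReal.ofReal_ne_top]
      ring

/-! ### Circles around points outside a simply connected set -/

lemma polarPt_eq_exp {ρ : ℝ} (hρ : 0 < ρ) (θ : ℝ) :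
    polarPt ρ θ = Complex.exp (Real.log ρ + θ * Complex.I) := by
  rw [Complex.exp_add, ← Complex.ofReal_exp, Real.exp_log hρ, Complex.exp_mul_I, polarPt]
  push_cast
  rfl

/-- A circle centred outside a simply connected open set is not contained in that set. -/
theorem exists_circle_point_notMem {U : Set ℂ} (hU : IsSimplyConnected U) (hUo : IsOpen U) {p : ℂ}
    (hp : p ∉ U) {ρ : ℝ} (hρ : 0 < ρ) : ∃ θ, p + polarPt ρ θ ∉ U := by
  by_contra! hcon
  -- On `U`, `f` is a continuous branch of `log (z - p)`. Along a circle contained in `U`, the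
  -- quantity `k` below would be continuous and integer valued, yet drop by 1 in one turn.
  obtain ⟨f, hfc, hf⟩ := Complex.exists_continuousOn_eqOn_exp_comp hU hUo
    (g := fun z => z - p) (by fun_prop) (by
      rintro ⟨z, hz, hzp⟩
      exact hp (sub_eq_zero.1 hzp ▸ hz))
  have hpt : Continuous (polarPt ρ) :=
    continuous_polarPt.comp (by fun_prop : Continuous fun θ : ℝ => (ρ, θ))
  let k : ℝ → ℝ := fun θ => ((f (p + polarPt ρ θ)).im - θ) / (2 * Real.pi)
  have hkc : Continuous k := by
    have h1 : Continuous fun θ => f (p + polarPt ρ θ) :=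
      hfc.comp_continuous (by fun_prop) hcon
    exact ((Complex.continuous_im.comp h1).sub continuous_id).div_const _
  have hπ := Real.pi_pos
  have hint : ∀ θ, ∃ n : ℤ, k θ = n := by
    intro θ
    have h1 : Complex.exp (f (p + polarPt ρ θ)) =
        Complex.exp (Real.log ρ + θ * Complex.I) := by
      have := hf (hcon θ)
      simp only [Function.comp_apply, add_sub_cancel_left] at this
      rw [this, polarPt_eq_exp hρ]
    obtain ⟨n, hn⟩ := Complex.exp_eq_exp_iff_exists_int.1 h1
    refine ⟨n, ?_⟩
    have him := congrArg Complex.im hn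
    simp at him
    simp only [k, him]
    field_simp
    ring
  have hk1 : k (2 * Real.pi) = k 0 - 1 := by
    have : polarPt ρ (2 * Real.pi) = polarPt ρ 0 := by
      simpa using polarPt_periodic ρ 0
    simp only [k, this]
    field_simp
    ring
  obtain ⟨θ, -, hθ⟩ := intermediate_value_Icc' (show (0 : ℝ) ≤ 2 * Real.pi by positivity)
    hkc.continuousOn (show k 0 - 1 / 2 ∈ Icc (k (2 * Real.pi)) (k 0) by
      rw [hk1]; constructor <;> linarith)
  obtain ⟨n, hn⟩ := hint θ
  obtain ⟨m, hm⟩ := hint 0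
  rw [hn, hm] at hθ
  have : (2 * n : ℤ) = 2 * m - 1 := by
    have : (2 * n : ℝ) = 2 * m - 1 := by linarith
    exact_mod_cast this
  omega

/-! ### Covering by discs -/

lemma setLIntegral_ball_translate (F : ℂ → ℝ≥0∞) (p : ℂ) (R : ℝ) :
    ∫⁻ z in Metric.ball 0 R, F (p + z) = ∫⁻ z in Metric.ball p R, F z := by
  rw [← lintegral_indicator Metric.isOpen_ball.measurableSet,
    ← lintegral_indicator Metric.isOpen_ball.measurableSet,
    ← lintegral_add_left_eq_self ((Metric.ball p R).indicator F) p]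
  refine lintegral_congr fun z => ?_
  simp [indicator, Metric.mem_ball, dist_eq_norm]

/-- The inner integral is enlarged to the whole plane, so that only the outer disc varies when the
inequalities are summed over the covering. -/
lemma ball_poincare_translate {s R : ℝ} (h0 : 1 / 2 < s) (hs : s < 1) {v : ℂ → ℝ}
    (hv : Continuous v) {p : ℂ} (hzero : ∀ ρ, 0 < ρ → ∃ θ, v (p + polarPt ρ θ) = 0) :
    ENNReal.ofReal (constC1 s) * ∫⁻ z in Metric.ball p R, ENNReal.ofReal (v z ^ 2) ≤
      ENNReal.ofReal (constC2 s) * (ENNReal.ofReal (15 / 2 * R ^ (2 * s)) *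
        ∫⁻ z in Metric.ball p R, ∫⁻ w, pairEnergy s v z w) := by
  have h := ball_poincare (R := R) h0 hs (v := fun z => v (p + z)) (by fun_prop)
    fun ρ hρ => hzero ρ hρ.1
  rw [setLIntegral_ball_translate (fun z => ENNReal.ofReal (v z ^ 2))] at h
  refine h.trans (mul_le_mul_right (mul_le_mul_right ?_ _) _)
  rw [← setLIntegral_ball_translate (fun z => ∫⁻ w, pairEnergy s v z w)]
  refine lintegral_mono fun z => ?_
  have he : ∀ w, pairEnergy s (fun z => v (p + z)) z w = pairEnergy s v (p + z) (p + w) :=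
    fun w => by simp [pairEnergy]
  simp only [he]
  rw [← lintegral_add_left_eq_self (fun w => pairEnergy s v (p + z) w) p]
  exact setLIntegral_le_lintegral _ _

/-- The cell with index `q` of the square grid of mesh `r`. -/
def gridCell (r : ℝ) (q : ℤ × ℤ) : Set ℂ := {z | ⌊z.re / r⌋ = q.1 ∧ ⌊z.im / r⌋ = q.2}

lemma measurableSet_gridCell (r : ℝ) (q : ℤ × ℤ) : MeasurableSet (gridCell r q) := by
  have h1 : Measurable fun z : ℂ => ⌊z.re / r⌋ :=
    Int.measurable_floor.comp (Complex.measurable_re.div_const r)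
  have h2 : Measurable fun z : ℂ => ⌊z.im / r⌋ :=
    Int.measurable_floor.comp (Complex.measurable_im.div_const r)
  exact (h1 (measurableSet_singleton q.1)).inter (h2 (measurableSet_singleton q.2))

lemma lintegral_eq_tsum_gridCell (r : ℝ) (F : ℂ → ℝ≥0∞) :
    ∫⁻ z, F z = ∑' q, ∫⁻ z in gridCell r q, F z := by
  rw [← lintegral_iUnion (measurableSet_gridCell r), ← setLIntegral_univ]
  · congr 2
    exact (eq_univ_of_forall fun z => mem_iUnion.2
      ⟨((⌊z.re / r⌋, ⌊z.im / r⌋) : ℤ × ℤ), show z ∈ gridCell r _ from ⟨rfl, rfl⟩⟩).symm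
  · intro q q' hqq
    rw [Function.onFun, Set.disjoint_left]
    rintro z ⟨h1, h2⟩ ⟨h3, h4⟩
    exact hqq (Prod.ext (h1.symm.trans h3) (h2.symm.trans h4))

lemma abs_sub_lt_of_floor_div_eq {r a b : ℝ} (hr : 0 < r) (h : ⌊a / r⌋ = ⌊b / r⌋) :
    |a - b| < r := by
  have := Int.abs_sub_lt_one_of_floor_eq_floor h
  rwa [← sub_div, abs_div, abs_of_pos hr, div_lt_one hr] at this

lemma norm_sub_lt_of_mem_gridCell {r : ℝ} (hr : 0 < r) {q : ℤ × ℤ} {z w : ℂ}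
    (hz : z ∈ gridCell r q) (hw : w ∈ gridCell r q) : ‖z - w‖ < Real.sqrt 2 * r := by
  have h1 := abs_sub_lt_of_floor_div_eq hr (hz.1.trans hw.1.symm)
  have h2 := abs_sub_lt_of_floor_div_eq hr (hz.2.trans hw.2.symm)
  rw [Complex.norm_eq_sqrt_sq_add_sq, Complex.sub_re, Complex.sub_im,
    ← Real.sqrt_sq hr.le, ← Real.sqrt_mul (by norm_num)]
  refine Real.sqrt_lt_sqrt (by positivity) ?_
  nlinarith [sq_lt_sq' (abs_lt.1 h1).1 (abs_lt.1 h1).2, sq_lt_sq' (abs_lt.1 h2).1 (abs_lt.1 h2).2]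

/-- Since `2 + √2 < 3.42`, the floor lies strictly between `b/r - 4.42` and `b/r + 3.42`, a window
of length below 8 with at most eight integers. -/
lemma floor_div_mem_Icc {r a b : ℝ} (hr : 0 < r) (h : |a - b| < (2 + Real.sqrt 2) * r) :
    ⌊a / r⌋ ∈ Finset.Icc ⌈b / r - 4.42⌉ (⌈b / r - 4.42⌉ + 7) := by
  have h2 : Real.sqrt 2 < 1.42 := by
    rw [Real.sqrt_lt' (by norm_num)]; norm_num
  have h1 : |a / r - b / r| < 3.42 := by
    rw [← sub_div, abs_div, abs_of_pos hr, div_lt_iff₀ hr]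
    nlinarith
  obtain ⟨h3, h4⟩ := abs_lt.1 h1
  have h5 := Int.floor_le (a / r)
  have h6 := Int.lt_floor_add_one (a / r)
  have h7 := Int.le_ceil (b / r - 4.42)
  rw [Finset.mem_Icc]
  constructor
  · refine Int.ceil_le.2 (by linarith)
  · have : (⌊a / r⌋ : ℝ) < (⌈b / r - 4.42⌉ : ℝ) + 8 := by linarith
    have : ⌊a / r⌋ < ⌈b / r - 4.42⌉ + 8 := by exact_mod_cast this
    omega

/-- At most `64` grid cells lie near a given point. -/
lemma exists_finset_gridCell_near {r : ℝ} (hr : 0 < r) (z : ℂ) :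
    ∃ S : Finset (ℤ × ℤ), S.card = 64 ∧
      ∀ q, ∀ x ∈ gridCell r q, ‖x - z‖ < (2 + Real.sqrt 2) * r → q ∈ S := by
  refine ⟨Finset.Icc ⌈z.re / r - 4.42⌉ (⌈z.re / r - 4.42⌉ + 7) ×ˢ
    Finset.Icc ⌈z.im / r - 4.42⌉ (⌈z.im / r - 4.42⌉ + 7), ?_, ?_⟩
  · rw [Finset.card_product, Int.card_Icc, Int.card_Icc]
    have : ∀ m : ℤ, (m + 7 + 1 - m).toNat = 8 := fun m => by omega
    rw [this, this]
  · rintro q x ⟨h1, h2⟩ hx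
    have hre := (Complex.abs_re_le_norm (x - z)).trans_lt hx
    have him := (Complex.abs_im_le_norm (x - z)).trans_lt hx
    rw [Complex.sub_re] at hre
    rw [Complex.sub_im] at him
    rw [Finset.mem_product, ← h1, ← h2]
    exact ⟨floor_div_mem_Icc hr hre, floor_div_mem_Icc hr him⟩

/-- Poincaré inequality for functions supported in a simply connected open set whose points are at
bounded distance from the complement. -/
theorem plane_poincare {s r : ℝ} (h0 : 1 / 2 < s) (hs : s < 1) (hr : 0 < r) {U : Set ℂ}
    (hU : IsSimplyConnected U) (hUo : IsOpen U) (hdist : ∀ x ∈ U, ∃ p, p ∉ U ∧ ‖x - p‖ ≤ r)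
    {v : ℂ → ℝ} (hv : Continuous v) (hvU : ∀ z, z ∉ U → v z = 0) :
    ENNReal.ofReal (constC1 s) * ∫⁻ z, ENNReal.ofReal (v z ^ 2) ≤
      ENNReal.ofReal (constC2 s * (480 * ((1 + Real.sqrt 2) * r) ^ (2 * s))) *
        ∫⁻ z, ∫⁻ w, pairEnergy s v z w := by
  classical
  set R := (1 + Real.sqrt 2) * r with hR
  have hchoice : ∀ q : ℤ × ℤ, ∃ p : ℂ, (gridCell r q ∩ U).Nonempty →
      p ∉ U ∧ ∃ x ∈ gridCell r q, ‖x - p‖ ≤ r := by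
    intro q
    by_cases hq : (gridCell r q ∩ U).Nonempty
    · obtain ⟨x, hxq, hxU⟩ := hq
      obtain ⟨p, hp, hxp⟩ := hdist x hxU
      exact ⟨p, fun _ => ⟨hp, x, hxq, hxp⟩⟩
    · exact ⟨0, fun h => absurd h hq⟩
  choose p hp using hchoice
  set G : ℂ → ℝ≥0∞ := fun z => ∫⁻ w, pairEnergy s v z w with hG
  have hGm : Measurable G :=
    Measurable.lintegral_prod_right' (f := fun p : ℂ × ℂ => pairEnergy s v p.1 p.2)
      (measurable_pairEnergy_comp s hv.measurable measurable_fst measurable_snd)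
  set K : ℝ≥0∞ := ENNReal.ofReal (constC2 s) * ENNReal.ofReal (15 / 2 * R ^ (2 * s)) with hK
  -- Cells that miss `U` get the empty set: `v` vanishes there, and no centre need be chosen.
  let D : ℤ × ℤ → Set ℂ := fun q =>
    if (gridCell r q ∩ U).Nonempty then Metric.ball (p q) R else ∅
  have hDm : ∀ q, MeasurableSet (D q) := fun q => by
    simp only [D]; split_ifs
    exacts [Metric.isOpen_ball.measurableSet, MeasurableSet.empty]
  have hcell : ∀ q, ENNReal.ofReal (constC1 s) *
      ∫⁻ z in gridCell r q, ENNReal.ofReal (v z ^ 2) ≤ K * ∫⁻ z in D q, G z := by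
    intro q
    by_cases hq : (gridCell r q ∩ U).Nonempty
    · obtain ⟨hpU, x, hx, hxp⟩ := hp q hq
      have hsub : gridCell r q ⊆ Metric.ball (p q) R := fun z hz => by
        rw [Metric.mem_ball, dist_eq_norm]
        have h1 := norm_sub_lt_of_mem_gridCell hr hz hx
        have h2 := norm_sub_le_norm_sub_add_norm_sub z x (p q)
        rw [hR]; linarith
      have hb := ball_poincare_translate (R := R) h0 hs hv (p := p q) fun ρ hρ => by
        obtain ⟨θ, hθ⟩ := exists_circle_point_notMem hU hUo hpU hρ
        exact ⟨θ, hvU _ hθ⟩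
      rw [← mul_assoc] at hb
      simp only [D, if_pos hq]
      exact (mul_le_mul_right (lintegral_mono_set hsub) _).trans hb
    · have : ∫⁻ z in gridCell r q, ENNReal.ofReal (v z ^ 2) = 0 := by
        rw [setLIntegral_congr_fun (g := fun _ => 0) (measurableSet_gridCell r q)]
        · simp
        · intro z hz
          have : z ∉ U := fun h => hq ⟨z, hz, h⟩
          simp [hvU z this]
      simp [this]
  -- If `z` lies in the disc of a cell, that cell has a point within `r + R = (2 + √2) r` of `z`.
  -- With the disc constant, `64 · 15/2 = 480`.
  have hoverlap : ∀ z, ∑' q, (D q).indicator G z ≤ 64 * G z := by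
    intro z
    obtain ⟨S, hScard, hS⟩ := exists_finset_gridCell_near hr z
    rw [tsum_eq_sum (s := S)]
    · refine (Finset.sum_le_card_nsmul S _ (G z) fun q _ => indicator_le_self' (by simp) z).trans ?_
      rw [hScard, nsmul_eq_mul]
      norm_num
    · intro q hq
      refine indicator_of_notMem (fun hz => hq ?_) _
      simp only [D] at hz
      split_ifs at hz with hne
      · obtain ⟨-, x, hx, hxp⟩ := hp q hne
        refine hS q x hx ?_
        rw [Metric.mem_ball, dist_eq_norm, norm_sub_rev] at hz
        have := norm_sub_le_norm_sub_add_norm_sub x (p q) z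
        rw [hR] at hz
        linarith
      · exact hz.elim
  calc ENNReal.ofReal (constC1 s) * ∫⁻ z, ENNReal.ofReal (v z ^ 2)
      = ∑' q, ENNReal.ofReal (constC1 s) *
          ∫⁻ z in gridCell r q, ENNReal.ofReal (v z ^ 2) := by
        rw [lintegral_eq_tsum_gridCell r, ENNReal.tsum_mul_left]
    _ ≤ ∑' q, K * ∫⁻ z in D q, G z := ENNReal.tsum_le_tsum hcell
    _ = K * ∫⁻ z, ∑' q, (D q).indicator G z := by
        rw [ENNReal.tsum_mul_left, lintegral_tsum fun q => (hGm.indicator (hDm q)).aemeasurable]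
        simp only [lintegral_indicator (hDm _)]
    _ ≤ K * ∫⁻ z, 64 * G z := by gcongr with z; exact hoverlap z
    _ = _ := by
        have hC2 := constC2_pos s
        rw [lintegral_const_mul' _ _ (by norm_num), ← mul_assoc, hK,
          show (64 : ℝ≥0∞) = ENNReal.ofReal 64 by simp, ← ENNReal.ofReal_mul hC2.le,
          ← ENNReal.ofReal_mul (by positivity)]
        congr 2
        ring

/-! ### Sobolev spaces -/

section Sobolev

variable {N : ℕ} {s : ℝ} {Ω : Set (EuclideanSpace ℝ (Fin N))}

/-- The Gagliardo difference quotient, an `L²` function on the product space. -/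
def differenceQuotient (s : ℝ) (u : EuclideanSpace ℝ (Fin N) → ℝ)
    (p : EuclideanSpace ℝ (Fin N) × EuclideanSpace ℝ (Fin N)) : ℝ :=
  (u p.1 - u p.2) / ‖p.1 - p.2‖ ^ (((N : ℝ) + 2 * s) / 2)

lemma aestronglyMeasurable_differenceQuotient {u : EuclideanSpace ℝ (Fin N) → ℝ}
    (hu : AEStronglyMeasurable u volume) :
    AEStronglyMeasurable (differenceQuotient s u) (volume.prod volume) := by
  have hm : Measurable fun p : EuclideanSpace ℝ (Fin N) × EuclideanSpace ℝ (Fin N) =>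
      ‖p.1 - p.2‖ ^ (((N : ℝ) + 2 * s) / 2) := (by fun_prop : Measurable fun
        p : EuclideanSpace ℝ (Fin N) × EuclideanSpace ℝ (Fin N) => ‖p.1 - p.2‖).pow_const _
  exact ((hu.comp_fst.sub hu.comp_snd).aemeasurable.div hm.aemeasurable).aestronglyMeasurable

lemma eLpNorm_two_eq_lintegral {α : Type*} [MeasurableSpace α] {μ : Measure α} (f : α → ℝ) :
    eLpNorm f 2 μ = (∫⁻ x, ENNReal.ofReal (f x ^ 2) ∂μ) ^ (1 / 2 : ℝ) := by
  rw [eLpNorm_eq_lintegral_rpow_enorm_toReal (by norm_num) (by norm_num)]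
  simp only [ENNReal.toReal_ofNat, ENNReal.rpow_ofNat]
  congr 2
  ext x
  rw [Real.enorm_eq_ofReal_abs, ← ENNReal.ofReal_pow (abs_nonneg _), sq_abs]

/-- The difference quotient is linear in `u`, so the triangle inequality for the seminorm becomes
Minkowski's inequality in L². -/
lemma gagliardoSeminorm_eq_eLpNorm {u : EuclideanSpace ℝ (Fin N) → ℝ}
    (hu : AEStronglyMeasurable u volume) :
    gagliardoSeminorm s u = eLpNorm (differenceQuotient s u) 2 (volume.prod volume) := by
  rw [eLpNorm_two_eq_lintegral, gagliardoSeminorm, gagliardoSq, lintegral_prod]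
  · congr 3
    ext x
    congr 1
    ext y
    rw [differenceQuotient, div_pow, sq_abs, ← Real.rpow_two (_ ^ (_ : ℝ)),
      ← Real.rpow_mul (norm_nonneg _), div_mul_cancel₀ _ two_ne_zero]
  · exact ((aestronglyMeasurable_differenceQuotient hu).aemeasurable.pow_const 2).ennreal_ofReal

lemma gagliardoSeminorm_le_add {u w : EuclideanSpace ℝ (Fin N) → ℝ}
    (hu : AEStronglyMeasurable u volume) (hw : AEStronglyMeasurable w volume) :
    gagliardoSeminorm s w ≤ gagliardoSeminorm s u + gagliardoSeminorm s fun x => u x - w x := by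
  have hd : AEStronglyMeasurable (fun x => u x - w x) volume := hu.sub hw
  rw [gagliardoSeminorm_eq_eLpNorm hu, gagliardoSeminorm_eq_eLpNorm hw,
    gagliardoSeminorm_eq_eLpNorm hd]
  have : differenceQuotient s w =
      differenceQuotient s u - differenceQuotient s fun x => u x - w x := by
    ext p
    simp only [differenceQuotient, Pi.sub_apply]
    ring
  rw [this]
  exact eLpNorm_sub_le (aestronglyMeasurable_differenceQuotient hu)
    (aestronglyMeasurable_differenceQuotient hd) (by norm_num)

/-- A Poincaré inequality for test functions extends to their closure. -/
lemma poincare_of_testFunction {k : ℝ≥0∞} (hk : k ≠ ⊤)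
    (h : ∀ φ, IsTestFunction Ω φ → k * eLpNorm φ 2 volume ≤ gagliardoSeminorm s φ)
    {u : EuclideanSpace ℝ (Fin N) → ℝ} (hu : MemSobolevZero s Ω u) :
    k * eLpNorm u 2 volume ≤ gagliardoSeminorm s u := by
  have hkey : ∀ ε : ℝ≥0∞, 0 < ε →
      k * eLpNorm u 2 volume ≤ gagliardoSeminorm s u + (1 + k) * ε := by
    intro ε hε
    obtain ⟨φ, hφ, hclose⟩ := hu.2 ε hε
    have hφm : AEStronglyMeasurable φ volume := hφ.1.continuous.aestronglyMeasurable
    have hum := hu.1.1.1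
    have h1 : eLpNorm u 2 volume ≤ eLpNorm φ 2 volume + ε := by
      have : u = φ + fun x => u x - φ x := by ext x; simp
      calc eLpNorm u 2 volume = eLpNorm (φ + fun x => u x - φ x) 2 volume := by rw [← this]
        _ ≤ eLpNorm φ 2 volume + eLpNorm (fun x => u x - φ x) 2 volume :=
          eLpNorm_add_le hφm (hum.sub hφm) (by norm_num)
        _ ≤ _ := by gcongr; exact le_self_add.trans hclose.le
    have h2 : gagliardoSeminorm s φ ≤ gagliardoSeminorm s u + ε :=
      (gagliardoSeminorm_le_add hum hφm).trans (by gcongr; exact le_add_self.trans hclose.le)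
    calc k * eLpNorm u 2 volume ≤ k * (eLpNorm φ 2 volume + ε) := by gcongr
      _ = k * eLpNorm φ 2 volume + k * ε := mul_add _ _ _
      _ ≤ gagliardoSeminorm s u + ε + k * ε := by gcongr; exact (h φ hφ).trans h2
      _ = _ := by ring
  have hk1 : 1 + k ≠ ⊤ := ENNReal.add_ne_top.2 ⟨by norm_num, hk⟩
  refine ENNReal.le_of_forall_pos_le_add fun ε hε _ => ?_
  have hε' : (ε : ℝ≥0∞) ≠ 0 := by simpa using hε.ne'
  -- Approximation costs `ε` in the seminorm and `k ε` in the L² norm, hence the division by `1 +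
  -- k`.
  have := hkey (ε / (1 + k)) (ENNReal.div_pos hε' hk1)
  rwa [ENNReal.mul_div_cancel (by simp) hk1] at this

/-- Elements of the closure are L² limits of functions vanishing off `Ω`, so they vanish there
almost everywhere. This makes the denominator of the Rayleigh quotient nonzero for nonzero `u`. -/
lemma ae_eq_zero_of_ae_eq_zero_restrict (hΩ : MeasurableSet Ω)
    {u : EuclideanSpace ℝ (Fin N) → ℝ} (hu : MemSobolevZero s Ω u)
    (h0 : eLpNorm u 2 (volume.restrict Ω) = 0) : u =ᵐ[volume] 0 := by
  have hc : eLpNorm u 2 (volume.restrict Ωᶜ) = 0 := by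
    refine le_antisymm (le_of_forall_gt fun ε hε => ?_) zero_le
    obtain ⟨φ, hφ, hclose⟩ := hu.2 ε hε
    have : eLpNorm u 2 (volume.restrict Ωᶜ) =
        eLpNorm (fun x => u x - φ x) 2 (volume.restrict Ωᶜ) := by
      refine eLpNorm_congr_ae ?_
      filter_upwards [ae_restrict_mem hΩ.compl] with x hx
      rw [image_eq_zero_of_notMem_tsupport fun h => hx (hφ.2.2 h), sub_zero]
    rw [this]
    exact ((eLpNorm_mono_measure _ Measure.restrict_le_self).trans le_self_add).trans_lt hclose
  have hum := hu.1.1.1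
  rw [eLpNorm_eq_zero_iff hum.restrict (by norm_num)] at h0 hc
  exact ae_of_ae_restrict_of_ae_restrict_compl Ω h0 hc

/-- The density argument runs on square roots, where the triangle inequality is available; squaring
then returns to the Rayleigh quotient. -/
lemma ofReal_le_fracEigenvalue (hΩ : MeasurableSet Ω) {A : ℝ}
    (h : ∀ φ, IsTestFunction Ω φ →
      ENNReal.ofReal A * ∫⁻ x, ENNReal.ofReal (φ x ^ 2) ≤ gagliardoSq s φ) :
    ENNReal.ofReal A ≤ fracEigenvalue s Ω := by
  refine le_iInf fun u => le_iInf fun hu => le_iInf fun hne => ?_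
  have hP := poincare_of_testFunction (k := ENNReal.ofReal A ^ (1 / 2 : ℝ))
    (ENNReal.rpow_ne_top_of_nonneg (by norm_num) ENNReal.ofReal_ne_top) (fun φ hφ => by
      rw [eLpNorm_two_eq_lintegral, gagliardoSeminorm, ← ENNReal.mul_rpow_of_nonneg _ _ (by norm_num)]
      exact ENNReal.rpow_le_rpow (h φ hφ) (by norm_num)) hu
  have hle : eLpNorm u 2 (volume.restrict Ω) ≤ eLpNorm u 2 volume :=
    eLpNorm_mono_measure _ Measure.restrict_le_self
  rw [ENNReal.le_div_iff_mul_le]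
  · calc ENNReal.ofReal A * eLpNorm u 2 (volume.restrict Ω) ^ 2
        ≤ (ENNReal.ofReal A ^ (1 / 2 : ℝ)) ^ 2 * eLpNorm u 2 volume ^ 2 := by
          gcongr
          rw [← ENNReal.rpow_natCast, ← ENNReal.rpow_mul]
          norm_num
      _ = (ENNReal.ofReal A ^ (1 / 2 : ℝ) * eLpNorm u 2 volume) ^ 2 := by rw [mul_pow]
      _ ≤ _ := by gcongr
  · left
    exact pow_ne_zero 2 fun h => hne (ae_eq_zero_of_ae_eq_zero_restrict hΩ hu h)
  · left
    exact ENNReal.pow_ne_top (hle.trans_lt hu.1.1.2).ne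

/-- The open ball about `x` with radius the distance to the complement lies in `Ω`. The complement
is nonempty because the whole space contains arbitrarily large balls. Positivity of the distance
later yields a positive inradius. -/
lemma exists_notMem_dist_le_inradius (hΩ : IsOpen Ω) (hr : inradius Ω < ⊤)
    {x : EuclideanSpace ℝ (Fin N)} (hx : x ∈ Ω) :
    ∃ p, p ∉ Ω ∧ 0 < dist x p ∧ dist x p ≤ (inradius Ω).toReal := by
  have hball : ∀ ρ, 0 < ρ → Metric.ball x ρ ⊆ Ω → ENNReal.ofReal ρ ≤ inradius Ω :=
    fun ρ h1 h2 => le_iSup_of_le ρ (le_iSup_of_le h1 (le_iSup_of_le ⟨x, hx, h2⟩ le_rfl))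
  have hne : Ωᶜ.Nonempty := by
    by_contra hemp
    rw [not_nonempty_iff_eq_empty, compl_empty_iff] at hemp
    have h1 := hball ((inradius Ω).toReal + 1) (by positivity) (by simp [hemp])
    rw [ENNReal.ofReal_le_iff_le_toReal hr.ne] at h1
    linarith
  obtain ⟨p, hp, hpd⟩ := hΩ.isClosed_compl.exists_infDist_eq_dist hne x
  have hpos : 0 < dist x p := dist_pos.2 fun h => hp (h ▸ hx)
  refine ⟨p, hp, hpos, ?_⟩
  rw [← ENNReal.ofReal_le_iff_le_toReal hr.ne]
  refine hball _ hpos ?_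
  rw [← hpd]
  exact Metric.ball_infDist_compl_subset

end Sobolev

/-! ### The planar inequality -/

/-- Dropping the term with `M` and using `1 + 2s ≥ 2` leaves `3 / (20 · 2 · 36) = 1 / 480`, exactly
the covering constant. -/
lemma constC_div_le {M s r : ℝ} (hM : 0 < M) (h0 : 1 / 2 < s) (hs : s < 1) (hr : 0 < r) :
    constC M s / r ^ (2 * s) ≤
      constC1 s / (constC2 s * (480 * ((1 + Real.sqrt 2) * r) ^ (2 * s))) := by
  have hT := constT_le hM (by linarith) hs
  have hC1 := constC1_pos hs
  have hC2 := constC2_pos s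
  have hμ := constMu_pos hs
  have hp : 0 < (1 + Real.sqrt 2) ^ (2 * s) := by positivity
  have hrp : 0 < r ^ (2 * s) := by positivity
  rw [Real.mul_rpow (by positivity) hr.le]
  calc constC M s / r ^ (2 * s)
      ≤ 3 * constMu s / (20 * (1 + 2 * s)) / (36 * (1 + Real.sqrt 2) ^ (2 * s)) /
          r ^ (2 * s) := by rw [constC]; gcongr
    _ ≤ 3 * constMu s / (20 * 2) / (36 * (1 + Real.sqrt 2) ^ (2 * s)) / r ^ (2 * s) := by
        gcongr
        linarith
    _ = _ := by rw [constMu]; field_simp; norm_num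

lemma gagliardoSq_eq_pairEnergy (s : ℝ) (φ : EuclideanSpace ℝ (Fin 2) → ℝ) :
    gagliardoSq s φ = ∫⁻ z : ℂ, ∫⁻ w : ℂ,
      pairEnergy s (fun z => φ (Complex.orthonormalBasisOneI.repr z)) z w := by
  set e := Complex.orthonormalBasisOneI.repr
  have he : MeasurePreserving e := e.measurePreserving
  have hemb : MeasurableEmbedding e := e.toHomeomorph.measurableEmbedding
  rw [gagliardoSq, ← he.lintegral_comp_emb hemb]
  refine lintegral_congr fun z => ?_
  rw [← he.lintegral_comp_emb hemb]
  refine lintegral_congr fun w => ?_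
  rw [pairEnergy, sq_abs, ← map_sub, e.norm_map]
  norm_num

lemma testFunction_poincare {M s : ℝ} (hM : 0 < M) (h0 : 1 / 2 < s) (hs : s < 1)
    {Ω : Set (EuclideanSpace ℝ (Fin 2))} (hΩo : IsOpen Ω) (hΩ : IsSimplyConnected Ω) {r : ℝ}
    (hr : 0 < r) (hdist : ∀ x ∈ Ω, ∃ p, p ∉ Ω ∧ dist x p ≤ r)
    {φ : EuclideanSpace ℝ (Fin 2) → ℝ} (hφ : IsTestFunction Ω φ) :
    ENNReal.ofReal (constC M s / r ^ (2 * s)) * ∫⁻ x, ENNReal.ofReal (φ x ^ 2) ≤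
      gagliardoSq s φ := by
  have hφc : Continuous φ := hφ.1.continuous
  rw [gagliardoSq_eq_pairEnergy s φ]
  set e := Complex.orthonormalBasisOneI.repr
  have he : MeasurePreserving e := e.measurePreserving
  have hemb : MeasurableEmbedding e := e.toHomeomorph.measurableEmbedding
  have hP := plane_poincare h0 hs hr (U := e ⁻¹' Ω)
    ((Homeomorph.isSimplyConnected_preimage e.toHomeomorph).2 hΩ)
    (hΩo.preimage e.continuous) (fun x hx => by
      obtain ⟨p, hp, hxp⟩ := hdist (e x) hx
      refine ⟨e.symm p, by simpa using hp, ?_⟩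
      rwa [← dist_eq_norm, ← e.dist_map, e.apply_symm_apply])
    (v := fun z => φ (e z)) (hφc.comp e.continuous) fun z hz =>
      image_eq_zero_of_notMem_tsupport fun h => hz (hφ.2.2 h)
  rw [he.lintegral_comp_emb hemb fun x => ENNReal.ofReal (φ x ^ 2)] at hP
  set L := ∫⁻ x, ENNReal.ofReal (φ x ^ 2)
  set B := constC2 s * (480 * ((1 + Real.sqrt 2) * r) ^ (2 * s)) with hB
  have hBpos : 0 < B := by
    have := constC2_pos s
    positivity
  calc ENNReal.ofReal (constC M s / r ^ (2 * s)) * L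
      ≤ ENNReal.ofReal (constC1 s / B) * L := by
        exact mul_le_mul' (ENNReal.ofReal_le_ofReal (constC_div_le hM h0 hs hr)) le_rfl
    _ = ENNReal.ofReal (constC1 s) * L / ENNReal.ofReal B := by
        rw [ENNReal.ofReal_div_of_pos hBpos, ENNReal.mul_div_right_comm]
    _ ≤ _ := ENNReal.div_le_of_le_mul' hP

/-- **Fractional Makai-Hayman inequality.** It holds for every positive value of the numerical
parameter `M`. -/
theorem constC_div_inradius_le_fracEigenvalue {M s : ℝ} (hM : 0 < M) (h0 : 1 / 2 < s) (hs : s < 1)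
    {Ω : Set (EuclideanSpace ℝ (Fin 2))} (hΩo : IsOpen Ω) (hΩ : IsSimplyConnected Ω)
    (hr : inradius Ω < ⊤) :
    ENNReal.ofReal (constC M s) / inradius Ω ^ (2 * s) ≤ fracEigenvalue s Ω := by
  have hdist := fun x hx => exists_notMem_dist_le_inradius hΩo hr (x := x) hx
  have hrpos : 0 < (inradius Ω).toReal := by
    obtain ⟨x, hx⟩ := hΩ.nonempty
    obtain ⟨p, -, h1, h2⟩ := hdist x hx
    linarith
  have heq : ENNReal.ofReal (constC M s) / inradius Ω ^ (2 * s) =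
      ENNReal.ofReal (constC M s / (inradius Ω).toReal ^ (2 * s)) := by
    rw [ENNReal.ofReal_div_of_pos (by positivity), ← ENNReal.ofReal_rpow_of_pos hrpos,
      ENNReal.ofReal_toReal hr.ne]
  rw [heq]
  exact ofReal_le_fracEigenvalue hΩo.measurableSet fun φ hφ =>
    testFunction_poincare hM h0 hs hΩo hΩ hrpos (fun x hx => by
      obtain ⟨p, hp, -, h2⟩ := hdist x hx
      exact ⟨p, hp, h2⟩) hφ

end FracMakaiHayman

end

theorem theorem1p1 :
    ∃ M : ℝ, 0 < M ∧
      (∀ s : ℝ, 1 / 2 < s → s < 1 →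
        0 < FracMakaiHayman.constC M s ∧
        ∀ Ω : Set (EuclideanSpace ℝ (Fin 2)), IsOpen Ω → IsSimplyConnected Ω →
          FracMakaiHayman.inradius Ω < ⊤ →
          ENNReal.ofReal (FracMakaiHayman.constC M s) / FracMakaiHayman.inradius Ω ^ (2 * s)
            ≤ FracMakaiHayman.fracEigenvalue s Ω) ∧
      (∃ a : ℝ, 0 < a ∧
        Tendsto (fun s : ℝ => FracMakaiHayman.constC M s / (s - 1 / 2)) (𝓝[>] (1 / 2)) (𝓝 a)) ∧
      (∃ b : ℝ, 0 < b ∧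
        Tendsto (fun s : ℝ => FracMakaiHayman.constC M s / (1 / (1 - s))) (𝓝[<] 1) (𝓝 b)) := by
  -- Any positive `M` would serve; 1 is taken for definiteness.
  refine ⟨1, one_pos, fun s h0 hs => ⟨FracMakaiHayman.constC_pos one_pos (by linarith) hs, ?_⟩,
    FracMakaiHayman.exists_tendsto_constC_half 1, FracMakaiHayman.exists_tendsto_constC_one one_pos⟩
  exact fun Ω hΩo hΩ hr =>
    FracMakaiHayman.constC_div_inradius_le_fracEigenvalue one_pos h0 hs hΩo hΩ hr
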